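/- Work in $\mathbb R^n$ with the Euclidean norm and inner product. For a unit vector $e\in\mathbb R^n$ and $\alpha\in(0,1)$ let $$C_{e,\alpha}:=\{x\in\mathbb R^n:\langle x,e\rangle\ge\alpha\|x\|\|e\|\},$$ and let $\Gamma_{e,\alpha}$ be the set of Lipschitz curves $\gamma:\mathbb R\to\mathbb R^n$ with $\gamma'(t)\in C_{e,\alpha}$ for almost every $t\in\mathbb R$. The $(e,\alpha)$-width of an open set $G\subset\mathbb R^n$ is $$w_{e,\alpha}(G):=\sup\{\mathcal H^1(G\cap\gamma(\mathbb R)):\gamma\in\Gamma_{e,\alpha}\},$$ where $\mathcal H^1$ is the one-dimensional Hausdorff measure, and that of an arbitrary $E\subset\mathbb R^n$ is $$w_{e,\alpha}(E):=\inf\{w_{e,\alpha}(G):G\supset E,\ G\text{ open}\}.$$ For $f:\mathbb R^n\to\mathbb R$ and $x,v\in\mathbb R^n$ put $$D^+f(x;v):=\limsup_{t\searrow0}\frac{f(x+tv)-f(x)}t,\qquad D_+f(x;v):=\liminf_{t\searrow0}\frac{f(x+tv)-f(x)}t.$$ **Corollary.** Let $\mu$ be a Radon measure on $\mathbb R^n$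 (a locally finite Borel measure) and let $T$ be a $\mu$-measurable map from $\mathbb R^n$ to $\bigcup_{m=0}^nG(n,m)$, the set of all linear subspaces of $\mathbb R^n$ with its usual topology (in which $V\mapsto$ the orthogonal projection onto $V$ is an embedding into the linear operators on $\mathbb R^n$). Suppose that for every unit vector $e\in\mathbb R^n$ and every $\alpha\in(0,1)$ the set $$\{x\in\mathbb R^n: C_{e,\alpha}\cap T(x)=\{0\}\}$$ is the union of a $\mu$-null set and a set $E$ with $w_{e,\alpha}(E)=0$. Then there is a Lipschitz function $f:\mathbb R^n\to\mathbb R$ such that for $\mu$-almost every $x\in\mathbb R^n$ there is $c>0$ with $$D^+f(x;v)-D_+f(x;v)\ge c\,\mathrm{dist}(v,T(x))\qquad\text{for every }v\in\mathbb R^n.$$ -/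

import Mathlib

open Set Filter Topology MeasureTheory
open scoped ENNReal

namespace ConeWidth

/-- The closed one-sided cone of all `x` with `⟪x, e⟫ ≥ α ‖x‖ ‖e‖`. -/
def cone {n : ℕ} (e : EuclideanSpace ℝ (Fin n)) (α : ℝ) : Set (EuclideanSpace ℝ (Fin n)) :=
  {x | α * ‖x‖ * ‖e‖ ≤ inner ℝ x e}

/-- The Lipschitz curves `γ : ℝ → ℝⁿ` with `γ'(t)` in the cone of `e, α` for almost every `t`. -/
def curves {n : ℕ} (e : EuclideanSpace ℝ (Fin n)) (α : ℝ) :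
    Set (ℝ → EuclideanSpace ℝ (Fin n)) :=
  {γ | (∃ K, LipschitzWith K γ) ∧ ∀ᵐ t : ℝ, ∃ v ∈ cone e α, HasDerivAt γ v t}

/-- The supremum, over the admissible curves, of the one-dimensional Hausdorff measure of the
part of the curve in `G`; it is used for open `G`. -/
noncomputable def openWidth {n : ℕ} (e : EuclideanSpace ℝ (Fin n)) (α : ℝ)
    (G : Set (EuclideanSpace ℝ (Fin n))) : ℝ≥0∞ :=
  ⨆ γ ∈ curves e α, Measure.hausdorffMeasure 1 (G ∩ range γ)

/-- The `(e, α)`-width of an arbitrary set: the infimum of the widths of its open supersets. -/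
noncomputable def width {n : ℕ} (e : EuclideanSpace ℝ (Fin n)) (α : ℝ)
    (E : Set (EuclideanSpace ℝ (Fin n))) : ℝ≥0∞ :=
  ⨅ (G : Set (EuclideanSpace ℝ (Fin n))) (_ : E ⊆ G) (_ : IsOpen G), openWidth e α G

/-- The usual topology on the set of all linear subspaces of `ℝⁿ` (the disjoint union of the
Grassmannians `G(n, m)`, `0 ≤ m ≤ n`): the one making the map from a subspace to the
orthogonal projection onto it an embedding into the space of linear operators. -/
noncomputable abbrev grassmannTopology (n : ℕ) :
    TopologicalSpace (Submodule ℝ (EuclideanSpace ℝ (Fin n))) :=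
  TopologicalSpace.induced
    (fun V : Submodule ℝ (EuclideanSpace ℝ (Fin n)) => V.starProjection) inferInstance

/-- `μ`-measurability of a field of linear subspaces: preimages of open sets are measurable
with respect to the completion of `μ`. -/
def MeasurableField {n : ℕ} (μ : Measure (EuclideanSpace ℝ (Fin n)))
    (T : EuclideanSpace ℝ (Fin n) → Submodule ℝ (EuclideanSpace ℝ (Fin n))) : Prop :=
  ∀ U, IsOpen[grassmannTopology n] U → NullMeasurableSet (T ⁻¹' U) μ

/-- The upper one-sided directional derivative. The real `limsup` is the true one whenever the
difference quotients are bounded, in particular for every Lipschitz `f`. -/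
noncomputable def upperDeriv {n : ℕ} (f : EuclideanSpace ℝ (Fin n) → ℝ)
    (x v : EuclideanSpace ℝ (Fin n)) : ℝ :=
  limsup (fun t : ℝ => (f (x + t • v) - f x) / t) (𝓝[>] 0)

/-- The lower one-sided directional derivative, with the same remark. -/
noncomputable def lowerDeriv {n : ℕ} (f : EuclideanSpace ℝ (Fin n) → ℝ)
    (x v : EuclideanSpace ℝ (Fin n)) : ℝ :=
  liminf (fun t : ℝ => (f (x + t • v) - f x) / t) (𝓝[>] 0)

end ConeWidth

/-! The function `f` is the limit of smooth functions with gradients `p j`, converging so fast that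
at some scale `r j` the limit is still affine with slope `p j x` up to `o(r j)`. It then suffices
that, at almost every `x`, the numbers `⟪p j x, v⟫` jump infinitely often by a fixed fraction of
`dist(v, T x)`.

A gradient can be altered in the direction `e` on a compact set of `(e, α)`-width zero by a
perturbation with arbitrarily small values. The potential is the supremum, over cone curves ending
at a point, of the length (in the `e`-coordinate) spent in a small neighbourhood of the set. After
mollification its gradient has `e`-component `1` on the set and orthogonal part at most `2 * α`
(`exists_smooth_plateau`). Multiplying it by a smooth coefficient gives any prescribed change along
`e` (`exists_perturbation`, `exists_step`).

Such sets come from a finite net of subspaces. If `T x` is close to `V`, every unit `e ⟂ V` has a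
cone meeting `T x` only at `0`, so the hypothesis applies. Taking `e` along the part of `b`
orthogonal to `V`, `⟪e, v⟫` controls the component along `b` of the part of `v` orthogonal to `T x`;
letting `b` recur through the coordinate vectors recovers the distance (`exists_layer`).

The gradients stay bounded because each direction is used twice: the `e`-component is first raised
inside the ball of radius `R`, then erased. Such a pair increases the norm only by errors, while `R`
grows twice as fast as the errors. Hence `R - ‖p‖`, which bounds the jump from below, stays away
from `0` (`exists_oscillating`). Borel–Cantelli puts almost every point in all but finitely many
layers. -/

namespace ConeWidth

/-! ### Cone curves and the potential of a set of small width -/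

/-- Curves parametrised by their `e`-coordinate whose chords lie in the cone. -/
structure IsGraphCurve {n : ℕ} (e : EuclideanSpace ℝ (Fin n)) (α : ℝ)
    (γ : ℝ → EuclideanSpace ℝ (Fin n)) : Prop where
  inner_eq : ∀ s, inner ℝ (γ s) e = s
  chord_le : ∀ s t, s ≤ t → α * ‖γ t - γ s‖ ≤ t - s

section GraphCurve

variable {n : ℕ} {e : EuclideanSpace ℝ (Fin n)} {α : ℝ} {γ : ℝ → EuclideanSpace ℝ (Fin n)}

theorem IsGraphCurve.lipschitz (h : IsGraphCurve e α γ) (hα : 0 < α) :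
    LipschitzWith (Real.toNNReal α⁻¹) γ := by
  refine LipschitzWith.of_dist_le_mul fun s t => ?_
  rw [Real.coe_toNNReal _ (inv_pos.2 hα).le, inv_mul_eq_div, le_div_iff₀ hα, mul_comm,
    dist_eq_norm, Real.dist_eq]
  rcases le_total s t with hst | hst
  · rw [norm_sub_rev, abs_sub_comm, abs_of_nonneg (sub_nonneg.2 hst)]
    exact h.chord_le s t hst
  · rw [abs_of_nonneg (sub_nonneg.2 hst)]
    exact h.chord_le t s hst

theorem isClosed_cone (e : EuclideanSpace ℝ (Fin n)) (α : ℝ) : IsClosed (cone e α) :=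
  isClosed_le (by fun_prop) (by fun_prop)

theorem IsGraphCurve.mem_curves (h : IsGraphCurve e α γ) (he : ‖e‖ = 1) (hα : 0 < α) :
    γ ∈ curves e α := by
  refine ⟨⟨_, h.lipschitz hα⟩, ?_⟩
  filter_upwards [(h.lipschitz hα).ae_differentiableAt_real] with t ht
  refine ⟨deriv γ t, ?_, ht.hasDerivAt⟩
  have h1 : Tendsto (slope γ t) (𝓝[>] t) (𝓝 (deriv γ t)) :=
    (hasDerivAt_iff_tendsto_slope.1 ht.hasDerivAt).mono_left
      (nhdsWithin_mono _ fun s hs => ne_of_gt hs)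
  refine (isClosed_cone e α).mem_of_tendsto h1 ?_
  filter_upwards [self_mem_nhdsWithin] with s hs
  have hs' : 0 < s - t := sub_pos.2 hs
  have h2 := h.chord_le t s (le_of_lt hs)
  simp only [cone, mem_ofPred_eq, slope, vsub_eq_sub, he, mul_one, norm_smul, inner_smul_left,
    inner_sub_left, h.inner_eq, norm_inv, Real.norm_eq_abs, abs_of_pos hs']
  rw [RCLike.conj_to_real, inv_mul_cancel₀ hs'.ne', mul_left_comm, inv_mul_le_iff₀ hs', mul_one]
  exact h2

/-- The projection `⟪·, e⟫` is 1-Lipschitz and inverts the parametrisation, so parameter length is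
at most Hausdorff measure. -/
theorem IsGraphCurve.volume_le (h : IsGraphCurve e α γ) (he : ‖e‖ = 1) (hα : 0 < α)
    (G : Set (EuclideanSpace ℝ (Fin n))) : volume {t | γ t ∈ G} ≤ openWidth e α G := by
  have hL : LipschitzWith 1 fun x : EuclideanSpace ℝ (Fin n) => inner ℝ x e := by
    refine LipschitzWith.of_dist_le_mul fun x y => ?_
    rw [Real.dist_eq, ← inner_sub_left, dist_eq_norm]
    simpa [he] using abs_real_inner_le_norm (x - y) e
  have himg : {t | γ t ∈ G} ⊆ (fun x => inner ℝ x e) '' (G ∩ range γ) := fun t ht =>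
    ⟨γ t, ⟨ht, mem_range_self t⟩, h.inner_eq t⟩
  calc volume {t | γ t ∈ G} ≤ volume ((fun x => inner ℝ x e) '' (G ∩ range γ)) :=
        measure_mono himg
    _ ≤ Measure.hausdorffMeasure 1 (G ∩ range γ) := by
        rw [← hausdorffMeasure_real]
        simpa using hL.hausdorffMeasure_image_le (zero_le_one) (G ∩ range γ)
    _ ≤ openWidth e α G := le_iSup₂ (f := fun γ (_ : γ ∈ curves e α) =>
        Measure.hausdorffMeasure 1 (G ∩ range γ)) γ (h.mem_curves he hα)

/-- Follow `γ` up to the parameter `a` and the direction `w` from then on. -/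
noncomputable def bend (γ : ℝ → EuclideanSpace ℝ (Fin n)) (a : ℝ)
    (w : EuclideanSpace ℝ (Fin n)) (t : ℝ) : EuclideanSpace ℝ (Fin n) :=
  γ (min t a) + (t - min t a) • w

theorem IsGraphCurve.bend (h : IsGraphCurve e α γ) (hα : 0 ≤ α) (a : ℝ)
    {w : EuclideanSpace ℝ (Fin n)} (hwe : inner ℝ w e = 1) (hw : α * ‖w‖ ≤ 1) :
    IsGraphCurve e α (bend γ a w) := by
  refine ⟨fun s => ?_, fun s t hst => ?_⟩
  · simp [ConeWidth.bend, inner_add_left, inner_smul_left, h.inner_eq, hwe]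
  · have h1 : min s a ≤ min t a := min_le_min_right a hst
    have h2 : 0 ≤ (t - min t a) - (s - min s a) := by
      rcases le_total s a with hs | hs <;> rcases le_total t a with ht | ht <;>
        simp [hs, ht] <;> linarith
    have h3 : ConeWidth.bend γ a w t - ConeWidth.bend γ a w s
        = (γ (min t a) - γ (min s a)) + ((t - min t a) - (s - min s a)) • w := by
      simp only [ConeWidth.bend, sub_smul]; abel
    have h4 := h.chord_le _ _ h1
    have h5 := norm_add_le (γ (min t a) - γ (min s a)) (((t - min t a) - (s - min s a)) • w)
    rw [← h3, norm_smul, Real.norm_eq_abs, abs_of_nonneg h2] at h5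
    have h6 := mul_le_mul_of_nonneg_left h5 hα
    have h7 := mul_le_mul_of_nonneg_left hw h2
    nlinarith

theorem bend_of_le (γ : ℝ → EuclideanSpace ℝ (Fin n)) {a t : ℝ}
    (w : EuclideanSpace ℝ (Fin n)) (h : t ≤ a) : bend γ a w t = γ t := by
  simp [bend, h]

theorem bend_of_ge (γ : ℝ → EuclideanSpace ℝ (Fin n)) {a t : ℝ}
    (w : EuclideanSpace ℝ (Fin n)) (h : a ≤ t) : bend γ a w t = γ a + (t - a) • w := by
  simp [bend, h]

/-- The gains of the graph curves ending on the ray from `x` in the direction `e`. -/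
def gains (e : EuclideanSpace ℝ (Fin n)) (α : ℝ) (G : Set (EuclideanSpace ℝ (Fin n)))
    (x : EuclideanSpace ℝ (Fin n)) : Set ℝ :=
  {r | ∃ γ s, IsGraphCurve e α γ ∧ 0 ≤ s ∧ γ (inner ℝ x e + s) = x + s • e ∧
    r = (volume {t | t ≤ inner ℝ x e + s ∧ γ t ∈ G}).toReal - s}

theorem isGraphCurve_line (he : ‖e‖ = 1) (hα1 : α ≤ 1) (x : EuclideanSpace ℝ (Fin n)) :
    IsGraphCurve e α fun t => x + (t - inner ℝ x e) • e := by
  refine ⟨fun s => ?_, fun s t hst => ?_⟩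
  · simp [inner_add_left, inner_smul_left, he]
  · have h1 : (x + (t - inner ℝ x e) • e) - (x + (s - inner ℝ x e) • e) = (t - s) • e := by
      simp only [sub_smul]; abel
    rw [h1, norm_smul, he, mul_one, Real.norm_eq_abs, abs_of_nonneg (sub_nonneg.2 hst)]
    nlinarith [sub_nonneg.2 hst]

/-- A function with small values that grows with slope one in the direction `e` in an open set
of small width and that is monotone along the cone. -/
theorem exists_coneMonotone (he : ‖e‖ = 1) (hα : 0 < α) (hα1 : α ≤ 1)
    {G : Set (EuclideanSpace ℝ (Fin n))} {ε : ℝ} (hε : 0 ≤ ε)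
    (hG : openWidth e α G ≤ ENNReal.ofReal ε) :
    ∃ g : EuclideanSpace ℝ (Fin n) → ℝ, (∀ x, 0 ≤ g x ∧ g x ≤ ε) ∧
      (∀ x, ∀ v ∈ cone e α, g x ≤ g (x + v)) ∧
      (∀ x t, 0 ≤ t → g (x + t • e) ≤ g x + t) ∧
      (∀ x t, 0 ≤ t → (∀ s, 0 ≤ s → s ≤ t → x + s • e ∈ G) → g x + t ≤ g (x + t • e)) := by
  have hee : inner ℝ e e = (1 : ℝ) := by simp [he]
  have hfin : ∀ (γ : ℝ → EuclideanSpace ℝ (Fin n)) a, IsGraphCurve e α γ →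
      volume {t | t ≤ a ∧ γ t ∈ G} ≤ ENNReal.ofReal ε := fun γ a h =>
    ((measure_mono fun t ht => ht.2).trans (h.volume_le he hα G)).trans hG
  have hmono : ∀ (γ γ' : ℝ → EuclideanSpace ℝ (Fin n)) a a', IsGraphCurve e α γ' →
      {t | t ≤ a ∧ γ t ∈ G} ⊆ {t | t ≤ a' ∧ γ' t ∈ G} →
      (volume {t | t ≤ a ∧ γ t ∈ G}).toReal ≤ (volume {t | t ≤ a' ∧ γ' t ∈ G}).toReal :=
    fun γ γ' a a' h hs => ENNReal.toReal_mono
      (ne_top_of_le_ne_top ENNReal.ofReal_ne_top (hfin γ' a' h)) (measure_mono hs)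
  have hle : ∀ x, ∀ r ∈ gains e α G x, r ≤ ε := by
    rintro x _ ⟨γ, s, hγ, hs, -, rfl⟩
    have := ENNReal.toReal_mono ENNReal.ofReal_ne_top (hfin γ (inner ℝ x e + s) hγ)
    rw [ENNReal.toReal_ofReal hε] at this
    linarith
  have hbdd : ∀ x, BddAbove (gains e α G x) := fun x => ⟨ε, hle x⟩
  have hline : ∀ x, ∃ r ∈ gains e α G x, 0 ≤ r := fun x =>
    ⟨_, ⟨_, 0, isGraphCurve_line he hα1 x, le_rfl, by simp, rfl⟩, by simp⟩
  have hne : ∀ x, (gains e α G x).Nonempty := fun x => (hline x).imp fun _ h => h.1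
  -- A curve arriving at `x + s • e` may be continued along `v`, rescaled to unit speed in the
  -- `e`-coordinate.
  have hext : ∀ x, ∀ v ∈ cone e α, v ≠ 0 → ∀ γ s, IsGraphCurve e α γ → 0 ≤ s →
      γ (inner ℝ x e + s) = x + s • e → ∃ γ', IsGraphCurve e α γ' ∧
        (∀ t ≤ inner ℝ x e + s, γ' t = γ t) ∧
        (∀ t, inner ℝ x e + s ≤ t → γ' t = x + s • e + ((t - (inner ℝ x e + s)) / inner ℝ v e) • v)
        := by
    intro x v hv hv0 γ s hγ hs hx
    have hv' : α * ‖v‖ ≤ inner ℝ v e := by simpa [cone, he] using hv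
    have hc : 0 < inner ℝ v e := lt_of_lt_of_le (mul_pos hα (norm_pos_iff.2 hv0)) hv'
    refine ⟨bend γ (inner ℝ x e + s) ((inner ℝ v e)⁻¹ • v), hγ.bend hα.le _ ?_ ?_,
      fun t ht => bend_of_le _ _ ht, fun t ht => ?_⟩
    · simp [inner_smul_left, hc.ne']
    · rw [norm_smul, norm_inv, Real.norm_eq_abs, abs_of_pos hc, mul_left_comm,
        inv_mul_le_iff₀ hc, mul_one]
      exact hv'
    · rw [bend_of_ge _ _ ht, hx, smul_smul, div_eq_mul_inv]
  refine ⟨fun x => sSup (gains e α G x), fun x => ⟨?_, csSup_le (hne x) (hle x)⟩, fun x v hv => ?_,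
    fun x t ht => ?_, fun x t ht hseg => ?_⟩
  · obtain ⟨r, hr, h0⟩ := hline x
    exact h0.trans (le_csSup (hbdd x) hr)
  · refine csSup_le (hne x) ?_
    rintro _ ⟨γ, s, hγ, hs, hx, rfl⟩
    rcases eq_or_ne v 0 with rfl | hv0
    · rw [add_zero]
      exact le_csSup (hbdd x) ⟨γ, s, hγ, hs, hx, rfl⟩
    have hv' : α * ‖v‖ ≤ inner ℝ v e := by simpa [cone, he] using hv
    have hc : 0 < inner ℝ v e := lt_of_lt_of_le (mul_pos hα (norm_pos_iff.2 hv0)) hv'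
    obtain ⟨γ', hγ', h1, h2⟩ := hext x v hv hv0 γ s hγ hs hx
    refine le_csSup_of_le (hbdd _) ⟨γ', s, hγ', hs, ?_, rfl⟩ (sub_le_sub_right
      (hmono γ γ' _ _ hγ' fun t ht => ⟨?_, ?_⟩) s)
    · rw [h2 _ (by rw [inner_add_left]; linarith), inner_add_left]
      have : (inner ℝ x e + inner ℝ v e + s - (inner ℝ x e + s)) / inner ℝ v e = 1 := by
        rw [div_eq_one_iff_eq hc.ne']; ring
      rw [this, one_smul]; abel
    · rw [inner_add_left]; linarith [ht.1]
    · rw [h1 t ht.1]; exact ht.2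
  -- A curve ending at `s` on the ray from `x + t • e` ends at `t + s` on the ray from `x`. Allowing
  -- endpoints along the ray, at the price `s`, is what caps the slope in the direction `e` at one.
  · refine csSup_le (hne _) ?_
    rintro _ ⟨γ, s, hγ, hs, hx, rfl⟩
    have e1 : inner ℝ (x + t • e) e + s = inner ℝ x e + (t + s) := by
      rw [inner_add_left, inner_smul_left, hee]; simp [add_assoc]
    rw [e1] at hx ⊢
    have := le_csSup (hbdd x) ⟨γ, t + s, hγ, add_nonneg ht hs, by rw [hx, add_smul, add_assoc], rfl⟩
    linarith
  · have hcone : e ∈ cone e α := by simp [cone, he, hα1]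
    have he0 : e ≠ 0 := by rintro rfl; simp at he
    rw [← le_sub_iff_add_le]
    refine csSup_le (hne _) ?_
    rintro _ ⟨γ, s, hγ, hs, hx, rfl⟩
    have e1 : ∀ r, inner ℝ (x + t • e) e + r = inner ℝ x e + (t + r) := fun r => by
      rw [inner_add_left, inner_smul_left, hee]; simp [add_assoc]
    -- If the curve ends beyond `x + t • e`, the price drops by `t`. Otherwise the segment up to `x
    -- + t • e`, which lies in `G`, adds length `t - s` and the price `s` is no longer paid.
    rcases le_total t s with hts | hts
    · have := le_csSup (hbdd (x + t • e)) ⟨γ, s - t, hγ, sub_nonneg.2 hts, by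
        rw [e1, add_sub_cancel, hx, sub_smul]; abel, rfl⟩
      rw [e1, add_sub_cancel] at this
      linarith
    · obtain ⟨γ', hγ', h1, h2⟩ := hext x e hcone he0 γ s hγ hs hx
      have := le_csSup (hbdd (x + t • e)) ⟨γ', 0, hγ', le_rfl, by
        rw [e1, h2 _ (by linarith), hee, div_one, add_zero, add_sub_add_left_eq_sub, sub_smul,
          zero_smul]; abel, rfl⟩
      rw [e1, add_zero, sub_zero] at this
      have h3 : volume {r | r ≤ inner ℝ x e + s ∧ γ r ∈ G} + ENNReal.ofReal (t - s)
          ≤ volume {r | r ≤ inner ℝ x e + t ∧ γ' r ∈ G} := by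
        have : ENNReal.ofReal (t - s) = volume (Ioc (inner ℝ x e + s) (inner ℝ x e + t)) := by
          rw [Real.volume_Ioc, add_sub_add_left_eq_sub]
        rw [this, ← measure_union _ measurableSet_Ioc]
        · refine measure_mono (union_subset (fun r hr => ⟨by linarith [hr.1], ?_⟩)
            fun r hr => ⟨hr.2, ?_⟩)
          · rw [h1 r hr.1]; exact hr.2
          · rw [h2 r hr.1.le, hee, div_one, add_assoc, ← add_smul]
            exact hseg _ (by linarith [hr.1]) (by linarith [hr.2])
        · exact disjoint_left.2 fun r hr hr' => absurd hr.1 (not_le.2 hr'.1)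
      have h4 := ENNReal.toReal_mono
        (ne_top_of_le_ne_top ENNReal.ofReal_ne_top (hfin γ' _ hγ')) h3
      rw [ENNReal.toReal_add (ne_top_of_le_ne_top ENNReal.ofReal_ne_top (hfin γ _ hγ))
        ENNReal.ofReal_ne_top, ENNReal.toReal_ofReal (sub_nonneg.2 hts)] at h4
      linarith

end GraphCurve

open scoped ContDiff Gradient

/-! ### Mollification and gradient bounds -/

section Mollification

variable {F : Type*} [NormedAddCommGroup F] [InnerProductSpace ℝ F] [FiniteDimensional ℝ F]

/-- Smoothing by averaging over a small ball. -/
theorem exists_mollification {g : F → ℝ} (hg : Continuous g) {δ : ℝ} (hδ : 0 < δ) :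
    ∃ h : F → ℝ, ContDiff ℝ ∞ h ∧
      (∀ x c, (∀ z, g (x - z) ≤ c) → h x ≤ c) ∧ (∀ x c, (∀ z, c ≤ g (x - z)) → c ≤ h x) ∧
      ∀ x y c, (∀ z, ‖z‖ < δ → g (x - z) ≤ g (y - z) + c) → h x ≤ h y + c := by
  borelize F
  let φ : ContDiffBump (0 : F) := ⟨δ / 2, δ, half_pos hδ, half_lt_self hδ⟩
  let w : F → ℝ := φ.normed volume
  have hw0 : ∀ z, 0 ≤ w z := φ.nonneg_normed
  have hw1 : ∫ z, w z = 1 := φ.integral_normed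
  have hwc : Continuous w := φ.continuous_normed
  have hws : HasCompactSupport w := φ.hasCompactSupport_normed
  have hwz : ∀ z, δ ≤ ‖z‖ → w z = 0 := fun z hz => by
    refine Function.notMem_support.1 fun h => ?_
    rw [φ.support_normed_eq, mem_ball_zero_iff] at h
    exact absurd h (not_lt.2 hz)
  have hint : ∀ x, Integrable fun z => w z * g (x - z) := fun x =>
    Continuous.integrable_of_hasCompactSupport (by fun_prop) hws.mul_right
  have hintw : Integrable w := hwc.integrable_of_hasCompactSupport hws
  have hconst : ∀ c, ∫ z, w z * c = c := fun c => by rw [integral_mul_const, hw1, one_mul]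
  refine ⟨fun x => ∫ z, w z * g (x - z), ?_, fun x c h => ?_, fun x c h => ?_, fun x y c h => ?_⟩
  · exact hws.contDiff_convolution_left (ContinuousLinearMap.lsmul ℝ ℝ) φ.contDiff_normed
      (hg.locallyIntegrable (μ := volume))
  · rw [← hconst c]
    exact integral_mono (hint x) (hintw.mul_const c)
      fun z => mul_le_mul_of_nonneg_left (h z) (hw0 z)
  · rw [← hconst c]
    exact integral_mono (hintw.mul_const c) (hint x)
      fun z => mul_le_mul_of_nonneg_left (h z) (hw0 z)
  · have e1 : (∫ z, w z * g (y - z)) + c = ∫ z, (w z * g (y - z) + w z * c) := by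
      rw [integral_add (hint y) (hintw.mul_const c), hconst]
    beta_reduce
    rw [e1]
    refine integral_mono (hint x) ((hint y).add (hintw.mul_const c)) fun z => ?_
    beta_reduce
    rw [← mul_add]
    rcases lt_or_ge ‖z‖ δ with hz | hz
    · exact mul_le_mul_of_nonneg_left (h z hz) (hw0 z)
    · simp [hwz z hz]

theorem inner_gradient_le_of_forall {h : F → ℝ} {x v : F} {c δ : ℝ} (hδ : 0 < δ)
    (hd : DifferentiableAt ℝ h x)
    (hc : ∀ t, 0 < t → t < δ → h (x + t • v) ≤ h x + c * t) : inner ℝ (∇ h x) v ≤ c := by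
  rw [inner_gradient_left]
  refine le_of_tendsto (hd.hasFDerivAt.hasLineDerivAt v).tendsto_slope_zero_right ?_
  filter_upwards [Ioo_mem_nhdsGT hδ] with t ht
  rw [smul_eq_mul, inv_mul_le_iff₀ ht.1]
  linarith [hc t ht.1 ht.2]

theorem le_inner_gradient_of_forall {h : F → ℝ} {x v : F} {c δ : ℝ} (hδ : 0 < δ)
    (hd : DifferentiableAt ℝ h x)
    (hc : ∀ t, 0 < t → t < δ → h x + c * t ≤ h (x + t • v)) : c ≤ inner ℝ (∇ h x) v := by
  rw [inner_gradient_left]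
  refine ge_of_tendsto (hd.hasFDerivAt.hasLineDerivAt v).tendsto_slope_zero_right ?_
  filter_upwards [Ioo_mem_nhdsGT hδ] with t ht
  rw [smul_eq_mul, le_inv_mul_iff₀ ht.1]
  linarith [hc t ht.1 ht.2]

end Mollification

/-! ### Smooth plateaus on compact sets of width zero -/

section Plateau

variable {n : ℕ} {e : EuclideanSpace ℝ (Fin n)} {α : ℝ}

theorem orthogonal_add_mem_cone (he : ‖e‖ = 1) (hα : 0 < α) (hα2 : α ≤ 1 / 2)
    {u : EuclideanSpace ℝ (Fin n)} (hu : inner ℝ u e = 0) :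
    u + (2 * α * ‖u‖) • e ∈ cone e α := by
  have h0 : (0 : ℝ) ≤ 2 * α * ‖u‖ := by positivity
  simp only [cone, mem_ofPred_eq, he, mul_one, inner_add_left, inner_smul_left, hu, zero_add]
  have h1 : ‖u + (2 * α * ‖u‖) • e‖ ≤ 2 * ‖u‖ := by
    refine (norm_add_le _ _).trans ?_
    rw [norm_smul, he, mul_one, Real.norm_eq_abs, abs_of_nonneg h0]
    nlinarith [norm_nonneg u]
  simp only [RCLike.conj_to_real, real_inner_self_eq_norm_sq, he]
  nlinarith

/-- Test the hypothesis with `u` the orthogonal part of `p` itself. -/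
theorem norm_sub_inner_smul_le {F : Type*} [NormedAddCommGroup F] [InnerProductSpace ℝ F]
    {p e : F} {κ : ℝ} (he : ‖e‖ = 1) (h : ∀ u : F, inner ℝ u e = 0 → inner ℝ p u ≤ κ * ‖u‖)
    (hκ : 0 ≤ κ) : ‖p - inner ℝ p e • e‖ ≤ κ := by
  set u := p - inner ℝ p e • e with hu
  have h1 : inner ℝ u e = 0 := by
    simp [hu, inner_sub_left, inner_smul_left, he]
  have h2 : inner ℝ p u = ‖u‖ ^ 2 := by
    have : p = u + inner ℝ p e • e := by simp [hu]
    conv_lhs => rw [this]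
    rw [inner_add_left, inner_smul_left, real_inner_comm u e, h1, real_inner_self_eq_norm_sq]
    simp
  have h3 := h u h1
  rw [h2] at h3
  rcases (norm_nonneg u).eq_or_lt with h4 | h4
  · rw [← h4]; exact hκ
  · nlinarith

/-- A smooth function with small values whose gradient is close to `e` on a compact set of
width zero and close to the segment from `0` to `e` everywhere. -/
theorem exists_smooth_plateau (he : ‖e‖ = 1) (hα : 0 < α) (hα2 : α ≤ 1 / 2)
    {K : Set (EuclideanSpace ℝ (Fin n))} (hK : IsCompact K) (hw : width e α K = 0) {ε : ℝ}
    (hε : 0 < ε) :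
    ∃ g : EuclideanSpace ℝ (Fin n) → ℝ, ContDiff ℝ ∞ g ∧ (∀ x, 0 ≤ g x ∧ g x ≤ ε) ∧
      (∀ x, 0 ≤ inner ℝ (∇ g x) e ∧ inner ℝ (∇ g x) e ≤ 1) ∧
      (∀ x, ‖∇ g x - inner ℝ (∇ g x) e • e‖ ≤ 2 * α) ∧ ∀ x ∈ K, inner ℝ (∇ g x) e = 1 := by
  obtain ⟨G, hKG, hG, hGw⟩ : ∃ G, K ⊆ G ∧ IsOpen G ∧ openWidth e α G < ENNReal.ofReal ε := by
    have : width e α K < ENNReal.ofReal ε := by rw [hw]; exact ENNReal.ofReal_pos.2 hε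
    simpa only [width, iInf_lt_iff, exists_prop] using this
  obtain ⟨g, hgb, hgc, hge, hgG⟩ := exists_coneMonotone he hα (by linarith) hε.le hGw.le
  have hconet : ∀ t : ℝ, 0 ≤ t → t • e ∈ cone e α := fun t ht => by
    simp only [cone, mem_ofPred_eq, he, norm_smul, inner_smul_left, real_inner_self_eq_norm_sq,
      Real.norm_eq_abs, abs_of_nonneg ht, RCLike.conj_to_real]
    nlinarith
  -- Go from `x + u` to `x + (2 * α * ‖u‖) • e` along the cone, where `g` increases, then compare
  -- with `x` using slope at most one along `e`.
  have hperp : ∀ x u, inner ℝ u e = 0 → g (x + u) ≤ g x + 2 * α * ‖u‖ := fun x u hu => by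
    have h1 := hgc (x + u) _ (orthogonal_add_mem_cone he hα hα2 (u := -u) (by simp [hu]))
    rw [norm_neg, ← add_assoc, add_neg_cancel_right] at h1
    exact h1.trans (hge x _ (by positivity))
  have hlip : LipschitzWith 3 g := by
    refine LipschitzWith.of_le_add_mul 3 fun x y => ?_
    set a := inner ℝ (x - y) e with ha
    set u := (x - y) - a • e with hu
    have hue : inner ℝ u e = 0 := by
      rw [hu, inner_sub_left, inner_smul_left, real_inner_self_eq_norm_sq, he, ← ha]; simp
    have hax : |a| ≤ ‖x - y‖ := by simpa [he] using abs_real_inner_le_norm (x - y) e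
    have hux : ‖u‖ ≤ ‖x - y‖ + |a| := by
      simpa [norm_smul, he] using norm_sub_le (x - y) (a • e)
    have h1 : g x ≤ g (y + u) + |a| := by
      have hxy : x = y + u + a • e := by rw [hu]; abel
      rcases le_total 0 a with h | h
      · conv_lhs => rw [hxy]
        rw [abs_of_nonneg h]
        exact hge _ _ h
      · have := hgc x _ (hconet (-a) (by linarith))
        have hxy' : x + (-a) • e = y + u := by rw [neg_smul]; nth_rewrite 1 [hxy]; abel
        rw [hxy'] at this
        linarith [abs_nonneg a]
    have h2 := hperp y u hue
    rw [dist_eq_norm]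
    push_cast
    nlinarith [norm_nonneg u]
  obtain ⟨δ, hδ, hδG⟩ := hK.exists_thickening_subset_open hG hKG
  -- Radius `δ / 2` leaves room for a segment of length below `δ / 2` along `e`: its translates by
  -- the averaging vectors stay in `G`.
  obtain ⟨h, hsm, hub, hlb, hcmp⟩ := exists_mollification hlip.continuous (half_pos hδ)
  have hd : ∀ x, DifferentiableAt ℝ h x := fun x => (hsm.differentiable (by simp)) x
  have hle1 : ∀ x, inner ℝ (∇ h x) e ≤ 1 := fun x =>
    inner_gradient_le_of_forall one_pos (hd x) fun t ht _ => hcmp _ _ _ fun z _ => by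
      rw [add_sub_right_comm, one_mul]; exact hge _ _ ht.le
  refine ⟨h, hsm, fun x => ⟨hlb _ _ fun z => (hgb _).1, hub _ _ fun z => (hgb _).2⟩,
    fun x => ⟨?_, hle1 x⟩, fun x => ?_, fun x hx => le_antisymm (hle1 x) ?_⟩
  · refine le_inner_gradient_of_forall one_pos (hd x) fun t ht _ => ?_
    rw [zero_mul, add_zero, ← add_zero (h (x + t • e))]
    refine hcmp _ _ _ fun z _ => ?_
    rw [add_sub_right_comm, add_zero]
    exact hgc _ _ (hconet t ht.le)
  · refine norm_sub_inner_smul_le he (fun u hu => ?_) (by linarith)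
    refine inner_gradient_le_of_forall one_pos (hd x) fun t ht _ => hcmp _ _ _ fun z _ => ?_
    have := hperp (x - z) (t • u) (by rw [inner_smul_left, hu, mul_zero])
    rw [norm_smul, Real.norm_eq_abs, abs_of_pos ht] at this
    rw [add_sub_right_comm]
    linarith
  · refine le_inner_gradient_of_forall (half_pos hδ) (hd x) fun t ht ht2 => ?_
    rw [one_mul, ← le_sub_iff_add_le, sub_eq_add_neg]
    refine hcmp _ _ _ fun z hz => ?_
    rw [add_sub_right_comm, ← sub_eq_add_neg, le_sub_iff_add_le]
    refine hgG _ _ ht.le fun s hs0 hs => hδG ?_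
    rw [Metric.mem_thickening_iff]
    refine ⟨x, hx, ?_⟩
    rw [dist_eq_norm, show x - z + s • e - x = s • e - z by abel]
    refine (norm_sub_le _ _).trans_lt ?_
    rw [norm_smul, he, mul_one, Real.norm_eq_abs, abs_of_nonneg hs0]
    linarith

end Plateau

/-! ### Moving one component of a vector within a ball -/

section Shift

variable {F : Type*} [NormedAddCommGroup F] [InnerProductSpace ℝ F]

/-- The multiple of `e` that moves the `e`-component of `p` to `θ (R² - ‖q‖²) / (2R)`, where
`q` is the part of `p` orthogonal to `e`. -/
noncomputable def shift (R θ : ℝ) (e p : F) : ℝ :=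
  θ * ((R ^ 2 - ‖p - inner ℝ p e • e‖ ^ 2) / (2 * R)) - inner ℝ p e

theorem contDiff_shift (R θ : ℝ) (e : F) : ContDiff ℝ ∞ (shift R θ e) := by
  unfold shift
  have h1 : ContDiff ℝ ∞ fun p : F => inner ℝ p e := contDiff_id.inner ℝ contDiff_const
  have h2 : ContDiff ℝ ∞ fun p : F => p - inner ℝ p e • e :=
    contDiff_id.sub (h1.smul contDiff_const)
  exact (contDiff_const.mul ((contDiff_const.sub (h2.norm_sq ℝ)).div_const _)).sub h1

theorem norm_sq_eq_of_norm_eq_one {e : F} (he : ‖e‖ = 1) (p : F) :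
    ‖p‖ ^ 2 = ‖p - inner ℝ p e • e‖ ^ 2 + inner ℝ p e ^ 2 := by
  rw [norm_sub_sq_real, inner_smul_right, norm_smul, he, Real.norm_eq_abs, mul_one, sq_abs]
  ring

theorem norm_sub_inner_smul_le_norm {e : F} (he : e = 0 ∨ ‖e‖ = 1) (p : F) :
    ‖p - inner ℝ p e • e‖ ≤ ‖p‖ := by
  rcases he with rfl | he
  · simp
  · have := norm_sq_eq_of_norm_eq_one he p
    exact abs_le_of_sq_le_sq' (by nlinarith [sq_nonneg (inner ℝ p e)]) (norm_nonneg p) |>.2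

theorem add_shift_smul (R θ : ℝ) (e p : F) :
    p + shift R θ e p • e = (p - inner ℝ p e • e) +
      (θ * ((R ^ 2 - ‖p - inner ℝ p e • e‖ ^ 2) / (2 * R))) • e := by
  rw [shift, sub_smul]; abel

variable {e p : F} {R θ : ℝ}

/-- The height `h = (R² - ‖q‖²) / (2R)` satisfies `2 * h ≤ R`, so `h² ≤ 2 * R * h = R² - ‖q‖²`.
Unlike `√(R² - ‖q‖²)`, it is smooth in `p`. -/
theorem norm_add_shift_smul_le (he : e = 0 ∨ ‖e‖ = 1) (hR : 0 < R) (hθ : θ ∈ Icc (0 : ℝ) 1)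
    (hp : ‖p‖ ≤ R) : ‖p + shift R θ e p • e‖ ≤ R := by
  have hq := (norm_sub_inner_smul_le_norm he p).trans hp
  rcases he with rfl | he
  · simpa using hp
  rw [add_shift_smul]
  set q := p - inner ℝ p e • e
  have hqe : inner ℝ q e = 0 := by
    simp [q, inner_sub_left, inner_smul_left, he]
  set h := (R ^ 2 - ‖q‖ ^ 2) / (2 * R) with hh
  have hq2 : ‖q‖ ^ 2 ≤ R ^ 2 := by gcongr
  have h0 : 0 ≤ h := div_nonneg (by linarith) (by linarith)
  have h1 : 2 * R * h = R ^ 2 - ‖q‖ ^ 2 := by rw [hh]; field_simp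
  have h2 : 2 * h ≤ R := by nlinarith [sq_nonneg ‖q‖]
  have h3 : ‖q + (θ * h) • e‖ ^ 2 = ‖q‖ ^ 2 + (θ * h) ^ 2 := by
    rw [norm_add_sq_real, inner_smul_right, hqe, norm_smul, he, Real.norm_eq_abs, mul_one, sq_abs]
    ring
  have h4 : θ * h ≤ h := mul_le_of_le_one_left h0 hθ.2
  have h5 : 0 ≤ θ * h := mul_nonneg hθ.1 h0
  refine abs_le_of_sq_le_sq' ?_ hR.le |>.2
  rw [h3]
  nlinarith

theorem abs_shift_le (he : ‖e‖ = 1) (hR : 0 < R) (hθ : θ ∈ Icc (0 : ℝ) 1)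
    (hp : ‖p‖ ≤ R) : |shift R θ e p| ≤ 2 * R := by
  have hq := (norm_sub_inner_smul_le_norm (Or.inr he) p).trans hp
  have h1 : |inner ℝ p e| ≤ R := by
    refine (abs_real_inner_le_norm p e).trans ?_
    rwa [he, mul_one]
  have hq2 : ‖p - inner ℝ p e • e‖ ^ 2 ≤ R ^ 2 := by gcongr
  have h0 : 0 ≤ (R ^ 2 - ‖p - inner ℝ p e • e‖ ^ 2) / (2 * R) :=
    div_nonneg (by linarith) (by linarith)
  have h2 : (R ^ 2 - ‖p - inner ℝ p e • e‖ ^ 2) / (2 * R) ≤ R := by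
    rw [div_le_iff₀ (by linarith)]
    nlinarith [sq_nonneg ‖p - inner ℝ p e • e‖]
  have h3 := mul_nonneg hθ.1 h0
  have h4 := mul_le_of_le_one_left h0 hθ.2
  have h5 := abs_le.1 h1
  rw [shift, abs_le]
  constructor <;> linarith [h5.1, h5.2]

theorem norm_add_mul_shift_smul_le (he : e = 0 ∨ ‖e‖ = 1) (hR : 0 < R)
    (hθ : θ ∈ Icc (0 : ℝ) 1) (hp : ‖p‖ ≤ R) {τ : ℝ} (hτ : τ ∈ Icc (0 : ℝ) 1) :
    ‖p + (τ * shift R θ e p) • e‖ ≤ R := by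
  have h1 : p + (τ * shift R θ e p) • e = (1 - τ) • p + τ • (p + shift R θ e p • e) := by
    module
  have := (convex_closedBall (0 : F) R) (mem_closedBall_zero_iff.2 hp)
    (mem_closedBall_zero_iff.2 (norm_add_shift_smul_le he hR hθ hp))
    (sub_nonneg.2 hτ.2) hτ.1 (by ring)
  rw [h1]
  exact mem_closedBall_zero_iff.1 this

end Shift

/-! ### Gradients of products, and cutoffs -/

section Gradient

variable {F : Type*} [NormedAddCommGroup F] [InnerProductSpace ℝ F] [CompleteSpace F]

theorem contDiff_gradient {f : F → ℝ} (hf : ContDiff ℝ ∞ f) : ContDiff ℝ ∞ (∇ f) :=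
  (InnerProductSpace.toDual ℝ F).symm.contDiff.comp (hf.fderiv_right (m := ∞) (by simp))

theorem norm_gradient_eq (f : F → ℝ) (x : F) : ‖∇ f x‖ = ‖fderiv ℝ f x‖ :=
  (InnerProductSpace.toDual ℝ F).symm.norm_map _

theorem gradient_add_mul {f ψ g : F → ℝ} {x : F} (hf : DifferentiableAt ℝ f x)
    (hψ : DifferentiableAt ℝ ψ x) (hg : DifferentiableAt ℝ g x) :
    ∇ (fun y => f y + ψ y * g y) x = ∇ f x + ψ x • ∇ g x + g x • ∇ ψ x := by
  refine ext_inner_right ℝ fun v => ?_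
  rw [inner_add_left, inner_add_left, inner_smul_left, inner_smul_left]
  simp only [inner_gradient_left]
  rw [fderiv_fun_add hf (hψ.fun_mul hg), fderiv_fun_mul hψ hg]
  simp
  ring

end Gradient

section Cutoff

variable {F : Type*} [NormedAddCommGroup F] [InnerProductSpace ℝ F] [FiniteDimensional ℝ F]

theorem exists_cutoff {K U : Set F} (hK : IsCompact K) (hU : IsOpen U) (hKU : K ⊆ U) :
    ∃ χ : F → ℝ, ContDiff ℝ ∞ χ ∧ HasCompactSupport χ ∧ tsupport χ ⊆ U ∧
      (∀ x, χ x ∈ Icc (0 : ℝ) 1) ∧ ∀ x ∈ K, χ x = 1 := by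
  obtain ⟨L, hL, hKL, hLU⟩ := exists_compact_between hK hU hKU
  obtain ⟨χ, h0, h1, h01⟩ := exists_contMDiffMap_zero_one_of_isClosed (n := ⊤)
    (modelWithCornersSelf ℝ F) isOpen_interior.isClosed_compl hK.isClosed
    (disjoint_left.2 fun x hx hxK => hx (hKL hxK))
  have hsupp : tsupport χ ⊆ L := by
    refine closure_minimal (fun x hx => ?_) hL.isClosed
    by_contra hxL
    exact hx (h0 fun h => hxL (interior_subset h))
  exact ⟨χ, χ.contMDiff.contDiff, hL.of_isClosed_subset (isClosed_tsupport _) hsupp,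
    hsupp.trans hLU, h01, fun x hx => h1 hx⟩

end Cutoff

/-! ### Perturbing the gradient along one layer -/

section Step

variable {n : ℕ} {α : ℝ}

/-- The perturbation is `ψ * g`, with `g` a plateau and `ψ` the cut-off shift of `∇ f`. In its
gradient `ψ • ∇ g + g • ∇ ψ` the second term is small because `g` is chosen after `ψ`, and the first
is nearly parallel to `e`. -/
theorem exists_perturbation {f : EuclideanSpace ℝ (Fin n) → ℝ} (hf : ContDiff ℝ ∞ f)
    {R θ η ε : ℝ} (hR : 0 < R) (hθ : θ ∈ Icc (0 : ℝ) 1) (hfR : ∀ x, ‖∇ f x‖ ≤ R)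
    (hα : 0 < α) (hα2 : α ≤ 1 / 2) (hη : 0 < η) (hαη : 8 * R * α ≤ η) (hε : 0 < ε)
    {K U : Set (EuclideanSpace ℝ (Fin n))} (hK : IsCompact K) (hU : IsOpen U) (hKU : K ⊆ U)
    {e : EuclideanSpace ℝ (Fin n)} (he : e = 0 ∨ ‖e‖ = 1 ∧ width e α K = 0) :
    ∃ g : EuclideanSpace ℝ (Fin n) → ℝ, ContDiff ℝ ∞ g ∧ HasCompactSupport g ∧ tsupport g ⊆ U ∧
      (∀ x, |g x| ≤ ε) ∧ ∀ x, ∃ τ ∈ Icc (0 : ℝ) 1, (x ∈ K → τ = 1) ∧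
        ‖∇ (fun y => f y + g y) x - (∇ f x + (τ * shift R θ e (∇ f x)) • e)‖ ≤ η := by
  rcases he with rfl | ⟨he, hw⟩
  · refine ⟨fun _ => 0, contDiff_const, .zero, by simp [tsupport], by simp [hε.le],
      fun x => ⟨1, by simp, by simp, ?_⟩⟩
    simp [hη.le]
  obtain ⟨χ, hχ, hχs, hχU, hχ01, hχK⟩ := exists_cutoff hK hU hKU
  set ψ : EuclideanSpace ℝ (Fin n) → ℝ := fun x => χ x * shift R θ e (∇ f x) with hψdef
  have hψ : ContDiff ℝ ∞ ψ := hχ.mul ((contDiff_shift R θ e).comp (contDiff_gradient hf))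
  have hψs : HasCompactSupport ψ := hχs.mul_right
  have hψχ : tsupport ψ ⊆ tsupport χ := closure_mono (Function.support_mul_subset_left _ _)
  obtain ⟨B, hB⟩ := (hψs.fderiv ℝ).exists_bound_of_continuous (hψ.continuous_fderiv (by simp))
  have hB0 : 0 ≤ B := (norm_nonneg _).trans (hB 0)
  have hψ2 : ∀ x, |ψ x| ≤ 2 * R := fun x => by
    rw [hψdef, abs_mul, abs_of_nonneg (hχ01 x).1]
    exact (mul_le_of_le_one_left (abs_nonneg _) (hχ01 x).2).trans (abs_shift_le he hR hθ (hfR x))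
  -- The first bound makes `|ψ * g| ≤ ε`, the second makes `g • ∇ ψ` at most `η / 2`. The remaining
  -- error is at most `2 * R * (2 * α) ≤ η / 2`.
  obtain ⟨g, hg, hgb, hg01, hgα, hgK⟩ := exists_smooth_plateau he hα hα2 hK hw
    (ε := min (ε / (2 * R)) (η / (2 * (B + 1)))) (by positivity)
  have hg1 : ∀ x, 2 * R * g x ≤ ε := fun x => by
    have := (hgb x).2.trans (min_le_left _ _)
    rwa [le_div_iff₀ (by positivity), mul_comm] at this
  have hg2 : ∀ x, g x * B ≤ η / 2 := fun x => by
    have := (hgb x).2.trans (min_le_right _ _)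
    rw [le_div_iff₀ (by positivity)] at this
    nlinarith [(hgb x).1]
  refine ⟨fun x => ψ x * g x, hψ.mul hg, hψs.mul_right,
    (closure_mono (Function.support_mul_subset_left _ _)).trans (hψχ.trans hχU), fun x => ?_,
    fun x => ⟨χ x * inner ℝ (∇ g x) e, ⟨mul_nonneg (hχ01 x).1 (hg01 x).1,
      mul_le_one₀ (hχ01 x).2 (hg01 x).1 (hg01 x).2⟩, fun hx => ?_, ?_⟩⟩
  · rw [abs_mul, abs_of_nonneg (hgb x).1]
    exact (mul_le_mul_of_nonneg_right (hψ2 x) (hgb x).1).trans (hg1 x)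
  · rw [hχK x hx, hgK x hx, mul_one]
  · rw [gradient_add_mul (hf.differentiable (by simp) x) (hψ.differentiable (by simp) x)
      (hg.differentiable (by simp) x)]
    have h1 : ∇ f x + ψ x • ∇ g x + g x • ∇ ψ x -
        (∇ f x + (χ x * inner ℝ (∇ g x) e * shift R θ e (∇ f x)) • e) =
        ψ x • (∇ g x - inner ℝ (∇ g x) e • e) + g x • ∇ ψ x := by
      simp only [hψdef]; module
    rw [h1]
    refine (norm_add_le _ _).trans ?_
    rw [norm_smul, norm_smul, Real.norm_eq_abs, Real.norm_eq_abs, abs_of_nonneg (hgb x).1,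
      norm_gradient_eq]
    have h2 := mul_le_mul (hψ2 x) (hgα x) (norm_nonneg _) (by positivity)
    have h3 := mul_le_mul_of_nonneg_left (hB x) (hgb x).1
    linarith [hg2 x]

/-- Finitely many disjoint compact sets, each with a unit vector in whose direction it has
width zero (or with the zero vector). -/
structure Layer (n : ℕ) (α : ℝ) where
  N : ℕ
  K : Fin N → Set (EuclideanSpace ℝ (Fin n))
  e : Fin N → EuclideanSpace ℝ (Fin n)
  isCompact : ∀ l, IsCompact (K l)
  disjoint : ∀ l l', l ≠ l' → Disjoint (K l) (K l')
  dir : ∀ l, e l = 0 ∨ ‖e l‖ = 1 ∧ width (e l) α (K l) = 0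

/-- Take the points strictly closer to `K l` than to the union of the other sets. -/
theorem exists_disjoint_open {X : Type*} [PseudoEMetricSpace X] {N : ℕ} {K : Fin N → Set X}
    (hK : ∀ l, IsClosed (K l)) (hd : ∀ l l', l ≠ l' → Disjoint (K l) (K l')) :
    ∃ U : Fin N → Set X, (∀ l, IsOpen (U l)) ∧ (∀ l, K l ⊆ U l) ∧
      ∀ l l', l ≠ l' → Disjoint (U l) (U l') := by
  let V : Fin N → Set X := fun l => ⋃ l' ∈ {l' : Fin N | l' ≠ l}, K l'
  have hKV : ∀ l l', l' ≠ l → K l' ⊆ V l := fun l l' h =>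
    subset_biUnion_of_mem (u := fun l' => K l') h
  have hV : ∀ l, IsClosed (V l) := fun l => (toFinite _).isClosed_biUnion fun l' _ => hK l'
  refine ⟨fun l => {x | Metric.infEDist x (K l) < Metric.infEDist x (V l)}, fun l =>
    isOpen_lt Metric.continuous_infEDist Metric.continuous_infEDist, fun l x hx => ?_,
    fun l l' hl => disjoint_left.2 fun x hx hx' => ?_⟩
  · have hxV : x ∉ V l := by
      simp only [V, mem_iUnion, not_exists]
      exact fun l' hl' hx' => disjoint_left.1 (hd l' l hl') hx' hx
    rw [mem_ofPred_eq, Metric.infEDist_zero_of_mem hx, pos_iff_ne_zero]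
    exact fun h => hxV ((Metric.mem_iff_infEDist_zero_of_closed (hV l)).2 h)
  · exact lt_asymm (hx.trans_le (Metric.infEDist_anti (hKV l l' hl.symm)))
      (hx'.trans_le (Metric.infEDist_anti (hKV l' l hl)))

/-- The perturbations have supports in disjoint open sets, so near each point at most one acts and
the bounds do not add up. -/
theorem exists_step (D : Layer n α) {f : EuclideanSpace ℝ (Fin n) → ℝ} (hf : ContDiff ℝ ∞ f)
    (hfs : HasCompactSupport f) {R θ η ε : ℝ} (hR : 0 < R) (hθ : θ ∈ Icc (0 : ℝ) 1)
    (hfR : ∀ x, ‖∇ f x‖ ≤ R) (hα : 0 < α) (hα2 : α ≤ 1 / 2) (hη : 0 < η)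
    (hαη : 8 * R * α ≤ η) (hε : 0 < ε) :
    ∃ f' : EuclideanSpace ℝ (Fin n) → ℝ, ContDiff ℝ ∞ f' ∧ HasCompactSupport f' ∧
      (∀ x, |f' x - f x| ≤ ε) ∧ (∀ x, ‖∇ f' x‖ ≤ R + η) ∧
      ∀ l, ∀ x ∈ D.K l, ‖∇ f' x - (∇ f x + shift R θ (D.e l) (∇ f x) • D.e l)‖ ≤ η := by
  obtain ⟨U, hU, hKU, hUd⟩ := exists_disjoint_open (fun l => (D.isCompact l).isClosed) D.disjoint
  choose g hg hgs hgU hgε hgτ using fun l => exists_perturbation hf hR hθ hfR hα hα2 hη hαη hε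
    (D.isCompact l) (hU l) (hKU l) (D.dir l)
  have hloc : ∀ x l, x ∈ U l → ∀ l', l' ≠ l → g l' x = 0 := fun x l hx l' hl => by
    by_contra h
    exact disjoint_left.1 (hUd l' l hl) (hgU l' (subset_tsupport _ h)) hx
  have hin : ∀ l, ∀ x ∈ U l, ∑ l', g l' x = g l x := fun l x hx =>
    Finset.sum_eq_single l (fun l' _ hl => hloc x l hx l' hl) (by simp)
  have hgin : ∀ l, ∀ x ∈ U l,
      ∇ (fun y => f y + ∑ l', g l' y) x = ∇ (fun y => f y + g l y) x := fun l x hx => by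
    refine Filter.EventuallyEq.gradient_eq ?_
    filter_upwards [(hU l).mem_nhds hx] with y hy
    rw [hin l y hy]
  have hout : ∀ x, (∀ l, x ∉ U l) → ∀ᶠ y in 𝓝 x, ∑ l', g l' y = 0 := fun x hx => by
    have : ∀ l, ∀ᶠ y in 𝓝 x, g l y = 0 := fun l => by
      filter_upwards [(isClosed_tsupport (g l)).isOpen_compl.mem_nhds
        fun h => hx l (hgU l h)] with y hy
      exact image_eq_zero_of_notMem_tsupport hy
    filter_upwards [eventually_all.2 this] with y hy
    exact Finset.sum_eq_zero fun l _ => hy l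
  refine ⟨fun x => f x + ∑ l, g l x, hf.add (ContDiff.sum fun l _ => hg l), ?_, fun x => ?_,
    fun x => ?_, fun l x hx => ?_⟩
  · refine hfs.add ?_
    have : (fun x => ∑ l, g l x) = ∑ l, g l := by ext x; simp
    rw [this]
    refine Finset.sum_induction g HasCompactSupport (fun _ _ h h' => h.add h') .zero fun l _ => hgs l
  · rw [add_sub_cancel_left]
    by_cases h : ∃ l, x ∈ U l
    · obtain ⟨l, hl⟩ := h
      rw [hin l x hl]
      exact hgε l x
    · rw [(hout x (not_exists.1 h)).self_of_nhds, abs_zero]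
      exact hε.le
  · by_cases h : ∃ l, x ∈ U l
    · obtain ⟨l, hl⟩ := h
      rw [hgin l x hl]
      obtain ⟨τ, hτ, -, h1⟩ := hgτ l x
      have h2 := norm_add_mul_shift_smul_le ((D.dir l).imp_right fun h => h.1) hR hθ (hfR x) hτ
      have h3 := norm_le_norm_add_norm_sub'
        (∇ (fun y => f y + g l y) x) (∇ f x + (τ * shift R θ (D.e l) (∇ f x)) • D.e l)
      linarith
    · have : ∇ (fun y => f y + ∑ l', g l' y) x = ∇ f x := by
        refine Filter.EventuallyEq.gradient_eq ?_
        filter_upwards [hout x (not_exists.1 h)] with y hy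
        rw [hy, add_zero]
      rw [this]
      linarith [hfR x]
  · rw [hgin l x (hKU l hx)]
    obtain ⟨τ, -, hτ, h1⟩ := hgτ l x
    rwa [hτ hx, one_mul] at h1

end Step

/-! ### The limit function and its difference quotients -/

section Limit

theorem exists_uniform_linear_approx {F : Type*} [NormedAddCommGroup F] [InnerProductSpace ℝ F]
    [CompleteSpace F] {f : F → ℝ} (hf : ContDiff ℝ ∞ f) (hfs : HasCompactSupport f)
    {κ ρ : ℝ} (hκ : 0 < κ) (hρ : 0 < ρ) :
    ∃ r, 0 < r ∧ r ≤ ρ ∧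
      ∀ x u, ‖u‖ ≤ r → |f (x + u) - f x - inner ℝ (∇ f x) u| ≤ κ * r := by
  have huc : UniformContinuous (fderiv ℝ f) :=
    (hfs.fderiv ℝ).uniformContinuous_of_continuous (hf.continuous_fderiv (by simp))
  obtain ⟨δ, hδ, h⟩ := Metric.uniformContinuous_iff.1 huc κ hκ
  refine ⟨min ρ (δ / 2), by positivity, min_le_left _ _, fun x u hu => ?_⟩
  have hu2 : ‖u‖ < δ := (hu.trans (min_le_right _ _)).trans_lt (half_lt_self hδ)
  have := (convex_ball x δ).norm_image_sub_le_of_norm_fderiv_le' (𝕜 := ℝ) (f := f)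
    (φ := fderiv ℝ f x) (C := κ) (x := x) (y := x + u)
    (fun z _ => hf.differentiable (by simp) z)
    (fun z hz => by rw [← dist_eq_norm]; exact (h hz).le) (Metric.mem_ball_self hδ)
    (by simpa using hu2)
  rw [add_sub_cancel_left, Real.norm_eq_abs, ← inner_gradient_left] at this
  exact this.trans (mul_le_mul_of_nonneg_left hu hκ.le)

theorem exists_seq_of_forall_step {σ : Type*} {P : ℕ → σ → Prop} {Q : ℕ → σ → σ → Prop}
    (h0 : ∃ s, P 0 s) (hs : ∀ j s, P j s → ∃ s', P (j + 1) s' ∧ Q j s s') :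
    ∃ s : ℕ → σ, ∀ j, P j (s j) ∧ Q j (s j) (s (j + 1)) := by
  choose s0 h0 using h0
  choose next h1 h2 using hs
  let t : ∀ j, {s // P j s} := fun j =>
    Nat.rec (motive := fun j => {s // P j s}) ⟨s0, h0⟩ (fun j s => ⟨next j s.1 s.2, h1 j s.1 s.2⟩) j
  exact ⟨fun j => (t j).1, fun j => ⟨(t j).2, h2 j (t j).1 (t j).2⟩⟩

variable {n : ℕ}

/-- Successive perturbations along the layers converge to a Lipschitz function whose difference
quotients at suitable scales are governed by the successive gradients. -/
theorem exists_lipschitz_limit {α θ R η : ℕ → ℝ} (D : ∀ j, Layer n (α j)) {B : ℝ}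
    (hR : ∀ j, 0 < R j) (hRB : ∀ j, R j ≤ B) (hθ : ∀ j, θ j ∈ Icc (0 : ℝ) 1)
    (hα : ∀ j, 0 < α j) (hα2 : ∀ j, α j ≤ 1 / 2) (hη : ∀ j, 0 < η j)
    (hαη : ∀ j, 8 * R j * α j ≤ η j) (hRη : ∀ j, R j + η j ≤ R (j + 1)) :
    ∃ (f : EuclideanSpace ℝ (Fin n) → ℝ)
      (p : ℕ → EuclideanSpace ℝ (Fin n) → EuclideanSpace ℝ (Fin n)) (r : ℕ → ℝ),
      (∃ K, LipschitzWith K f) ∧ (∀ j, 0 < r j ∧ r j ≤ 1 / (j + 1)) ∧ (∀ j x, ‖p j x‖ ≤ R j) ∧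
      (∀ j l, ∀ x ∈ (D j).K l,
        ‖p (j + 1) x - (p j x + shift (R j) (θ j) ((D j).e l) (p j x) • (D j).e l)‖ ≤ η j) ∧
      ∀ j x u, ‖u‖ ≤ r j → |f (x + u) - f x - inner ℝ (p j x) u| ≤ 3 / (j + 1) * r j := by
  -- A state is `(f, r, δ)`: `r` is a scale of good affine approximation and `δ` bounds the total of
  -- all later changes. It is at least halved at each step, and the next change is at most `δ / 4`.
  obtain ⟨s, hs⟩ := exists_seq_of_forall_step
    (σ := (EuclideanSpace ℝ (Fin n) → ℝ) × ℝ × ℝ)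
    (P := fun j s => ContDiff ℝ ∞ s.1 ∧ HasCompactSupport s.1 ∧ (∀ x, ‖∇ s.1 x‖ ≤ R j) ∧
      (0 < s.2.1 ∧ s.2.1 ≤ 1 / (j + 1)) ∧ (0 < s.2.2 ∧ s.2.2 ≤ 1 / (j + 1) * s.2.1) ∧
      ∀ x u, ‖u‖ ≤ s.2.1 → |s.1 (x + u) - s.1 x - inner ℝ (∇ s.1 x) u| ≤ 1 / (j + 1) * s.2.1)
    (Q := fun j s s' => (∀ x, |s'.1 x - s.1 x| ≤ s.2.2 / 4) ∧ s'.2.2 ≤ s.2.2 / 2 ∧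
      ∀ l, ∀ x ∈ (D j).K l, ‖∇ s'.1 x -
        (∇ s.1 x + shift (R j) (θ j) ((D j).e l) (∇ s.1 x) • (D j).e l)‖ ≤ η j)
    ⟨(fun _ => 0, 1, 1), contDiff_const, .zero, fun x => by simp [(hR 0).le], by simp, by simp,
      fun x u _ => by simp⟩
    (by
      rintro j ⟨f, r, δ⟩ ⟨hf, hfs, hfR, -, ⟨hδ, -⟩, -⟩
      obtain ⟨f', hf', hfs', hff', hfR', hK⟩ := exists_step (D j) hf hfs (hR j) (hθ j) hfR (hα j)
        (hα2 j) (hη j) (hαη j) (ε := δ / 4) (by positivity)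
      obtain ⟨r', hr', hr1, happ⟩ := exists_uniform_linear_approx hf' hfs'
        (κ := 1 / (((j + 1 : ℕ) : ℝ) + 1)) (ρ := 1 / (((j + 1 : ℕ) : ℝ) + 1))
        (by positivity) (by positivity)
      exact ⟨(f', r', min (δ / 2) (1 / (((j + 1 : ℕ) : ℝ) + 1) * r')),
        ⟨hf', hfs', fun x => (hfR' x).trans (hRη j), ⟨hr', hr1⟩,
          ⟨lt_min (by positivity) (by positivity), min_le_right _ _⟩, happ⟩,
        hff', min_le_left _ _, hK⟩)
  set F : ℕ → EuclideanSpace ℝ (Fin n) → ℝ := fun j => (s j).1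
  set r : ℕ → ℝ := fun j => (s j).2.1
  set δ : ℕ → ℝ := fun j => (s j).2.2
  have hδ0 : ∀ j, 0 < δ j := fun j => (hs j).1.2.2.2.2.1.1
  have hδgeom : ∀ j i, δ (j + i) ≤ δ j / 2 ^ i := fun j i => by
    induction i with
    | zero => simp
    | succ i ih =>
      have := (hs (j + i)).2.2.1
      calc δ (j + (i + 1)) ≤ δ (j + i) / 2 := this
        _ ≤ δ j / 2 ^ i / 2 := by gcongr
        _ = δ j / 2 ^ (i + 1) := by rw [pow_succ, div_div]
  have hdist : ∀ j x i, dist (F (j + i) x) (F (j + (i + 1)) x) ≤ δ j / 2 / 2 ^ i :=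
    fun j x i => by
      rw [dist_comm, Real.dist_eq]
      refine ((hs (j + i)).2.1 x).trans ?_
      have h1 := hδgeom j i
      have h2 : (0 : ℝ) ≤ δ j / 2 ^ i := div_nonneg (hδ0 j).le (by positivity)
      rw [div_right_comm]
      change δ (j + i) / 4 ≤ _
      linarith
  have hlim : ∀ x, ∃ y, Tendsto (fun j => F j x) atTop (𝓝 y) := fun x =>
    cauchySeq_tendsto_of_complete (cauchySeq_of_le_geometric_two (C := δ 0) fun i => by
      simpa using hdist 0 x i)
  choose f hf using hlim
  have hclose : ∀ j x, |F j x - f x| ≤ δ j := fun j x => by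
    rw [← Real.dist_eq]
    have h1 : Tendsto (fun i => F (j + i) x) atTop (𝓝 (f x)) := by
      simpa only [add_comm j] using (tendsto_add_atTop_iff_nat j).2 (hf x)
    exact dist_le_of_le_geometric_two_of_tendsto₀ (f := fun i => F (j + i) x) (hdist j x) h1
  have hB : 0 ≤ B := (hR 0).le.trans (hRB 0)
  refine ⟨f, fun j => ∇ (F j), r, ⟨B.toNNReal, LipschitzWith.of_dist_le_mul fun x y => ?_⟩,
    fun j => (hs j).1.2.2.2.1, fun j => (hs j).1.2.2.1, fun j => (hs j).2.2.2, fun j x u hu => ?_⟩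
  · refine le_of_tendsto ((hf x).dist (hf y)) (Eventually.of_forall fun j => ?_)
    have hL : LipschitzWith B.toNNReal (F j) := lipschitzWith_of_nnnorm_fderiv_le
      ((hs j).1.1.differentiable (by simp)) fun x => by
        rw [← NNReal.coe_le_coe, coe_nnnorm, Real.coe_toNNReal _ hB, ← norm_gradient_eq]
        exact ((hs j).1.2.2.1 x).trans (hRB j)
    exact hL.dist_le_mul x y
  · have h1 := (hs j).1.2.2.2.2.2 x u hu
    have h2 := abs_le.1 (hclose j x)
    have h3 := abs_le.1 (hclose j (x + u))
    have h4 : δ j ≤ 1 / (j + 1) * r j := (hs j).1.2.2.2.2.1.2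
    have h5 := abs_le.1 h1
    -- One third is the affine error of `F j`; the other two are the distances from `F j` to `f` at
    -- `x` and at `x + u`.
    have h6 : 3 / ((j : ℝ) + 1) * r j = 3 * (1 / (j + 1) * r j) := by ring
    rw [h6]
    simp only [F, r] at *
    rw [abs_le]
    constructor <;> linarith [h2.1, h2.2, h3.1, h3.2, h5.1, h5.2]

end Limit

/-! ### Layers adapted to the field of subspaces -/

section Layers

variable {n : ℕ}

theorem width_mono (e : EuclideanSpace ℝ (Fin n)) (α : ℝ) {K E : Set (EuclideanSpace ℝ (Fin n))}
    (h : K ⊆ E) : width e α K ≤ width e α E :=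
  le_iInf₂ fun G hG => le_iInf fun hGo => iInf₂_le_of_le G (h.trans hG) (iInf_le _ hGo)

/-- Orthogonal projections lie in the unit ball of a finite-dimensional space, hence form a totally
bounded set. -/
theorem exists_finite_net (n : ℕ) {α : ℝ} (hα : 0 < α) :
    ∃ (N : ℕ) (V : Fin N → Submodule ℝ (EuclideanSpace ℝ (Fin n))),
      ∀ W : Submodule ℝ (EuclideanSpace ℝ (Fin n)),
        ∃ l, ‖W.starProjection - (V l).starProjection‖ < α := by
  have htb : TotallyBounded (range fun W : Submodule ℝ (EuclideanSpace ℝ (Fin n)) =>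
      W.starProjection) := by
    refine (isCompact_closedBall (0 : EuclideanSpace ℝ (Fin n) →L[ℝ] EuclideanSpace ℝ (Fin n))
      1).totallyBounded.subset ?_
    rintro _ ⟨W, rfl⟩
    exact mem_closedBall_zero_iff.2 W.starProjection_norm_le
  obtain ⟨t, hts, htf, ht⟩ := htb.exists_subset (Metric.dist_mem_uniformity hα)
  obtain ⟨N, g, hg⟩ := htf.fin_param
  obtain ⟨-, hg⟩ := hg
  choose V hV using fun l => hts (show g l ∈ t from hg ▸ mem_range_self l)
  refine ⟨N, V, fun W => ?_⟩
  obtain ⟨y, hy, hWy⟩ := mem_iUnion₂.1 (ht (mem_range_self W))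
  rw [← hg] at hy
  obtain ⟨l, rfl⟩ := hy
  refine ⟨l, ?_⟩
  rw [← dist_eq_norm]
  simpa [hV l] using hWy

/-- For `y ∈ W` the vector `e ⟂ V` sees only the difference of the projections: `⟪y, e⟫ = ⟪(P_W -
P_V) y, e⟫`, which is below `α * ‖y‖` unless `y = 0`. -/
theorem cone_inter_eq_singleton {e : EuclideanSpace ℝ (Fin n)} {α : ℝ} (he : ‖e‖ = 1)
    {V W : Submodule ℝ (EuclideanSpace ℝ (Fin n))} (heV : e ∈ Vᗮ)
    (h : ‖W.starProjection - V.starProjection‖ < α) :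
    cone e α ∩ (W : Set (EuclideanSpace ℝ (Fin n))) = {0} := by
  refine Subset.antisymm (fun y hy => ?_) ?_
  · by_contra hy0
    have hy0' : 0 < ‖y‖ := norm_pos_iff.2 hy0
    have h1 : α * ‖y‖ ≤ inner ℝ y e := by simpa [cone, he] using hy.1
    have h2 : inner ℝ y e = inner ℝ ((W.starProjection - V.starProjection) y) e := by
      rw [_root_.sub_apply, inner_sub_left,
        Submodule.starProjection_eq_self_iff.2 hy.2,
        (Submodule.mem_orthogonal V e).1 heV _ (V.starProjection_apply_mem y), sub_zero]
    have h3 := real_inner_le_norm ((W.starProjection - V.starProjection) y) e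
    have h4 := (W.starProjection - V.starProjection).le_opNorm y
    rw [he, mul_one, ← h2] at h3
    nlinarith
  · rintro _ rfl
    exact ⟨by simp [cone], W.zero_mem⟩

theorem abs_inner_sub_starProjection_le {b e : EuclideanSpace ℝ (Fin n)} (hb : ‖b‖ ≤ 1) {α : ℝ}
    {V W : Submodule ℝ (EuclideanSpace ℝ (Fin n))}
    (he : e = ‖b - V.starProjection b‖⁻¹ • (b - V.starProjection b))
    (h : ‖W.starProjection - V.starProjection‖ < α) (v : EuclideanSpace ℝ (Fin n)) :
    |inner ℝ b (v - W.starProjection v)| ≤ |inner ℝ e v| + α * ‖v‖ := by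
  set w := b - V.starProjection b with hw
  have hw1 : ‖w‖ ≤ 1 := by
    have : w = Vᗮ.starProjection b := by
      rw [hw, Submodule.starProjection_orthogonal_val]
    rw [this]
    exact (Vᗮ.norm_starProjection_apply_le b).trans hb
  have h1 : inner ℝ b (v - W.starProjection v) =
      inner ℝ w v - inner ℝ b ((W.starProjection - V.starProjection) v) := by
    rw [hw, inner_sub_left, V.inner_starProjection_left_eq_right, _root_.sub_apply,
      inner_sub_right, inner_sub_right]
    ring
  have h2 : inner ℝ w v = ‖w‖ * inner ℝ e v := by
    rcases eq_or_ne w 0 with h0 | h0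
    · simp [h0]
    · rw [he, inner_smul_left, RCLike.conj_to_real, ← mul_assoc,
        mul_inv_cancel₀ (norm_ne_zero_iff.2 h0), one_mul]
  have h3 := abs_real_inner_le_norm b ((W.starProjection - V.starProjection) v)
  have h4 := (W.starProjection - V.starProjection).le_opNorm v
  have h5 : |inner ℝ w v| ≤ |inner ℝ e v| := by
    rw [h2, abs_mul, abs_norm]
    exact mul_le_of_le_one_left (abs_nonneg _) hw1
  rw [h1]
  refine (abs_sub _ _).trans (add_le_add h5 (h3.trans ?_))
  nlinarith [norm_nonneg v, norm_nonneg ((W.starProjection - V.starProjection) v)]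

/-- Up to small measure the space is covered by a layer adapted to the field of subspaces. -/
theorem exists_layer {ν : Measure (EuclideanSpace ℝ (Fin n))} [IsFiniteMeasure ν]
    {T : EuclideanSpace ℝ (Fin n) → Submodule ℝ (EuclideanSpace ℝ (Fin n))}
    (hT : MeasurableField ν T) {α : ℝ} (hα : 0 < α)
    (hw : ∀ e : EuclideanSpace ℝ (Fin n), ‖e‖ = 1 →
      ∃ Z E : Set (EuclideanSpace ℝ (Fin n)), ν Z = 0 ∧ width e α E = 0 ∧
        {x | cone e α ∩ (T x : Set (EuclideanSpace ℝ (Fin n))) = {0}} = Z ∪ E)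
    {b : EuclideanSpace ℝ (Fin n)} (hb : ‖b‖ ≤ 1) {ε : ℝ≥0∞} (hε : ε ≠ 0) :
    ∃ D : Layer n α, ν (⋃ l, D.K l)ᶜ ≤ ε ∧ ∀ l, ∀ x ∈ D.K l, ∀ v,
      |inner ℝ b (v - (T x).starProjection v)| ≤ |inner ℝ (D.e l) v| + α * ‖v‖ := by
  obtain ⟨N, V, hV⟩ := exists_finite_net n hα
  have hN : N ≠ 0 := by
    rintro rfl
    exact (hV ⊥).elim fun l _ => l.elim0
  let B : Fin N → Set (EuclideanSpace ℝ (Fin n)) := fun l =>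
    T ⁻¹' {W | ‖W.starProjection - (V l).starProjection‖ < α}
  have hBm : ∀ l, NullMeasurableSet (B l) ν := fun l => hT _ (by
    refine isOpen_induced_iff.2 ⟨Metric.ball (V l).starProjection α, Metric.isOpen_ball, ?_⟩
    ext W
    simp [dist_eq_norm])
  let w : Fin N → EuclideanSpace ℝ (Fin n) := fun l => b - (V l).starProjection b
  let e : Fin N → EuclideanSpace ℝ (Fin n) := fun l => ‖w l‖⁻¹ • w l
  have heV : ∀ l, e l ∈ (V l)ᗮ := fun l =>
    Submodule.smul_mem _ _ ((V l).sub_starProjection_mem_orthogonal b)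
  have hZ : ∀ l, ∃ Z, ν Z = 0 ∧ (e l = 0 ∨ ‖e l‖ = 1 ∧ ∀ K ⊆ B l \ Z, width (e l) α K = 0) := by
    intro l
    rcases eq_or_ne (w l) 0 with h0 | h0
    · exact ⟨∅, measure_empty, Or.inl (by simp [e, h0])⟩
    · have he1 : ‖e l‖ = 1 := norm_smul_inv_norm h0
      obtain ⟨Z, E, hZ, hE, hZE⟩ := hw (e l) he1
      refine ⟨Z, hZ, Or.inr ⟨he1, fun K hK => le_antisymm ?_ zero_le⟩⟩
      rw [← hE]
      refine width_mono _ _ fun x hx => ?_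
      have : x ∈ Z ∪ E := by
        rw [← hZE]
        exact cone_inter_eq_singleton he1 (heV l) (hK hx).1
      exact this.resolve_left (hK hx).2
  choose Z hZ0 hZw using hZ
  -- Assigning each point to the first close net element makes the pieces disjoint; inner regularity
  -- then gives the compact sets, each losing at most `ε / N`.
  let A : Fin N → Set (EuclideanSpace ℝ (Fin n)) := fun l =>
    (B l \ ⋃ l' ∈ {l' : Fin N | l' < l}, B l') \ Z l
  have hAm : ∀ l, NullMeasurableSet (A l) ν := fun l =>
    ((hBm l).diff (NullMeasurableSet.biUnion (to_countable _) fun l' _ => hBm l')).diff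
      (NullMeasurableSet.of_null (hZ0 l))
  have hAd : ∀ l l', l < l' → Disjoint (A l) (A l') := fun l l' hl =>
    disjoint_left.2 fun x hx hx' => hx'.1.2 (mem_biUnion (mem_ofPred.2 hl) hx.1.1)
  choose A' hA'A hA'm hA' using fun l => (hAm l).exists_measurable_subset_ae_eq
  have hε' : ε / N ≠ 0 := ENNReal.div_ne_zero.2 ⟨hε, ENNReal.natCast_ne_top N⟩
  choose K hKA' hKc hK using fun l => (hA'm l).exists_isCompact_sdiff_lt (measure_ne_top ν _) hε'
  have hKA : ∀ l, K l ⊆ A l := fun l => (hKA' l).trans (hA'A l)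
  refine ⟨⟨N, K, e, hKc, fun l l' hl => ?_, fun l => (hZw l).imp_right fun h =>
    ⟨h.1, h.2 _ fun x hx => ⟨(hKA l hx).1.1, (hKA l hx).2⟩⟩⟩, ?_, fun l x hx v => ?_⟩
  · rcases lt_or_gt_of_ne hl with h | h
    · exact (hAd l l' h).mono (hKA l) (hKA l')
    · exact ((hAd l' l h).mono (hKA l') (hKA l)).symm
  · have hcov : (⋃ l, K l)ᶜ ⊆ ⋃ l, (Z l ∪ (A l \ A' l)) ∪ (A' l \ K l) := fun x hx => by
      obtain ⟨l, hl, hmin⟩ := wellFounded_lt.has_min {l | x ∈ B l} (hV (T x))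
      have hxK : x ∉ K l := fun h => hx (mem_iUnion.2 ⟨l, h⟩)
      refine mem_iUnion.2 ⟨l, ?_⟩
      by_cases hxZ : x ∈ Z l
      · exact Or.inl (Or.inl hxZ)
      have hxA : x ∈ A l := ⟨⟨hl, fun h => by
        obtain ⟨l', hl', hx'⟩ := mem_iUnion₂.1 h
        exact hmin l' hx' hl'⟩, hxZ⟩
      by_cases hxA' : x ∈ A' l
      · exact Or.inr ⟨hxA', hxK⟩
      · exact Or.inl (Or.inr ⟨hxA, hxA'⟩)
    calc ν (⋃ l, K l)ᶜ ≤ ν (⋃ l, (Z l ∪ (A l \ A' l)) ∪ (A' l \ K l)) := measure_mono hcov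
      _ ≤ ∑ l, ν ((Z l ∪ (A l \ A' l)) ∪ (A' l \ K l)) := measure_iUnion_fintype_le _ _
      _ ≤ ∑ _l : Fin N, ε / N := Finset.sum_le_sum fun l _ => by
          have h1 : ν (A l \ A' l) = 0 := ae_le_set.1 (hA' l).symm.le
          refine (measure_union_le _ _).trans ?_
          rw [measure_union_null (hZ0 l) h1, zero_add]
          exact (hK l).le
      _ ≤ ε := by
          rw [Finset.sum_const, Finset.card_univ, Fintype.card_fin, nsmul_eq_mul]
          exact ENNReal.mul_div_le
  · exact abs_inner_sub_starProjection_le hb rfl (hKA l hx).1.1 v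

end Layers

/-! ### Recurrent test directions -/

section Directions

/-- The coordinate vectors, repeated cyclically. If all coordinates of `w` were below `‖w‖ / (n +
1)`, their sum could not reach `‖w‖`. -/
theorem exists_recurrent_directions (n : ℕ) :
    ∃ b : ℕ → EuclideanSpace ℝ (Fin n), (∀ m, ‖b m‖ ≤ 1) ∧
      ∀ w, ∃ᶠ m in atTop, ‖w‖ / (n + 1) ≤ |inner ℝ (b m) w| := by
  rcases Nat.eq_zero_or_pos n with rfl | hn
  · exact ⟨fun _ => 0, by simp, fun w =>
      (Eventually.of_forall fun m => by simp [Subsingleton.elim w 0]).frequently⟩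
  refine ⟨fun m => EuclideanSpace.single ⟨m % n, Nat.mod_lt m hn⟩ 1, fun m => by simp,
    fun w => ?_⟩
  obtain ⟨i, hi⟩ : ∃ i : Fin n, ‖w‖ / (n + 1) ≤ |w i| := by
    by_contra! h
    have h1 : ‖w‖ ≤ ∑ i, |w i| := by
      calc ‖w‖ = ‖∑ i, w i • EuclideanSpace.single i (1 : ℝ)‖ := by
            congr 1
            simpa using ((EuclideanSpace.basisFun (Fin n) ℝ).sum_repr w).symm
        _ ≤ ∑ i, |w i| := (norm_sum_le _ _).trans_eq (by simp [norm_smul])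
    have h2 : ∑ i, |w i| ≤ n * (‖w‖ / (n + 1)) := by
      refine (Finset.sum_le_sum fun i _ => (h i).le).trans_eq ?_
      simp
    have h3 : 0 < ‖w‖ / (n + 1) := (abs_nonneg _).trans_lt (h ⟨0, hn⟩)
    have h4 : ‖w‖ = (n + 1) * (‖w‖ / (n + 1)) := by field_simp
    linarith
  refine frequently_atTop.2 fun a => ⟨i + n * a, ?_, ?_⟩
  · exact (Nat.le_mul_of_pos_left a hn).trans (Nat.le_add_left _ _)
  · have : (⟨(i + n * a) % n, Nat.mod_lt _ hn⟩ : Fin n) = i := by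
      ext; simp [Nat.mod_eq_of_lt i.2]
    beta_reduce
    rw [this, EuclideanSpace.inner_single_left]
    simpa using hi

end Directions

/-! ### From oscillating quotients to directional derivatives -/

section Oscillation

variable {n : ℕ} {f : EuclideanSpace ℝ (Fin n) → ℝ}

theorem le_upperDeriv_sub_lowerDeriv {C : NNReal} (hf : LipschitzWith C f)
    {x v : EuclideanSpace ℝ (Fin n)} {A : ℝ}
    (h : ∀ ε > 0, ∀ ρ > 0, ∃ t t', (0 < t ∧ t < ρ) ∧ (0 < t' ∧ t' < ρ) ∧
      A - ε ≤ |(f (x + t • v) - f x) / t - (f (x + t' • v) - f x) / t'|) :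
    A ≤ upperDeriv f x v - lowerDeriv f x v := by
  have hb : ∀ᶠ t in 𝓝[>] (0 : ℝ), |(f (x + t • v) - f x) / t| ≤ C * ‖v‖ := by
    filter_upwards [self_mem_nhdsWithin] with t ht
    have ht : 0 < t := ht
    rw [abs_div, abs_of_pos ht, div_le_iff₀ ht]
    have := hf.dist_le_mul (x + t • v) x
    rw [Real.dist_eq, dist_eq_norm, add_sub_cancel_left, norm_smul, Real.norm_eq_abs,
      abs_of_pos ht] at this
    linarith
  have hu : IsBoundedUnder (· ≤ ·) (𝓝[>] (0 : ℝ)) fun t => (f (x + t • v) - f x) / t :=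
    isBoundedUnder_of_eventually_le (hb.mono fun t ht => (abs_le.1 ht).2)
  have hl : IsBoundedUnder (· ≥ ·) (𝓝[>] (0 : ℝ)) fun t => (f (x + t • v) - f x) / t :=
    isBoundedUnder_of_eventually_ge (hb.mono fun t ht => (abs_le.1 ht).1)
  refine le_of_forall_pos_le_add fun ε hε => ?_
  have h1 := eventually_lt_of_limsup_lt (b := upperDeriv f x v + ε / 3)
    (by rw [← upperDeriv]; linarith) hu
  have h2 := eventually_lt_of_lt_liminf (b := lowerDeriv f x v - ε / 3)
    (by rw [← lowerDeriv]; linarith) hl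
  obtain ⟨ρ, hρ, hsub⟩ := mem_nhdsGT_iff_exists_Ioo_subset.1 (h1.and h2)
  obtain ⟨t, t', ht, ht', hA⟩ := h (ε / 3) (by positivity) ρ hρ
  have h3 := hsub ht
  have h4 := hsub ht'
  have h5 : |(f (x + t • v) - f x) / t - (f (x + t' • v) - f x) / t'| ≤
      upperDeriv f x v - lowerDeriv f x v + 2 * (ε / 3) :=
    abs_le.2 ⟨by linarith [h3.1, h3.2, h4.1, h4.2], by linarith [h3.1, h3.2, h4.1, h4.2]⟩
  linarith

theorem abs_quotient_sub_le {x v p : EuclideanSpace ℝ (Fin n)} {κ r : ℝ} (hr : 0 < r)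
    (h : ∀ u, ‖u‖ ≤ r → |f (x + u) - f x - inner ℝ p u| ≤ κ * r) :
    |(f (x + (r / (‖v‖ + 1)) • v) - f x) / (r / (‖v‖ + 1)) - inner ℝ p v| ≤ κ * (‖v‖ + 1) := by
  have hv : 0 < ‖v‖ + 1 := by positivity
  set t := r / (‖v‖ + 1) with ht
  have ht0 : 0 < t := div_pos hr hv
  have htr : t * (‖v‖ + 1) = r := div_mul_cancel₀ r hv.ne'
  have h1 := h (t • v) (by
    rw [norm_smul, Real.norm_eq_abs, abs_of_pos ht0]
    nlinarith)
  rw [inner_smul_right, ← htr] at h1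
  have h2 : (f (x + t • v) - f x) / t - inner ℝ p v =
      (f (x + t • v) - f x - t * inner ℝ p v) / t := by field_simp
  rw [h2, abs_div, abs_of_pos ht0, div_le_iff₀ ht0]
  linarith

end Oscillation

/-! ### Raising and then erasing a component -/

section ShiftPair

variable {F : Type*} [NormedAddCommGroup F] [InnerProductSpace ℝ F]
  {e p q p' : F} {R R' η η' : ℝ}

theorem norm_sub_sub_le_of_shift_zero (h' : ‖p' - (q + shift R' 0 e q • e)‖ ≤ η') :
    ‖p' - (q - inner ℝ q e • e)‖ ≤ η' := by
  rwa [shift, zero_mul, zero_sub, neg_smul, ← sub_eq_add_neg] at h'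

/-- Up to errors the pair replaces `p` by its part orthogonal to `e`, which is no longer than `p`.
-/
theorem norm_le_of_shift_pair (he : e = 0 ∨ ‖e‖ = 1)
    (h : ‖q - (p + shift R 1 e p • e)‖ ≤ η) (h' : ‖p' - (q + shift R' 0 e q • e)‖ ≤ η') :
    ‖p'‖ ≤ ‖p‖ + (η + η') := by
  have h0 := norm_sub_sub_le_of_shift_zero h'
  set d := q - (p + shift R 1 e p • e) with hd
  have h1 : q - inner ℝ q e • e = (d - inner ℝ d e • e) + (p - inner ℝ p e • e) := by
    rcases he with rfl | he
    · simp [hd]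
    · simp only [hd, inner_sub_left, inner_add_left, inner_smul_left, RCLike.conj_to_real,
        real_inner_self_eq_norm_sq, he]
      module
  have h2 := norm_sub_inner_smul_le_norm he d
  have h3 := norm_sub_inner_smul_le_norm he p
  have h4 := norm_add_le (d - inner ℝ d e • e) (p - inner ℝ p e • e)
  have h5 := norm_le_norm_add_norm_sub' p' (q - inner ℝ q e • e)
  rw [h1] at h5 h0
  linarith

/-- Up to errors `q - p'` is `⟪q, e⟫ • e`, and the raised height is at least `(R² - ‖p‖²) / (2R) ≥
(R - ‖p‖) / 2`. -/
theorem le_abs_inner_of_shift_pair (he : e = 0 ∨ ‖e‖ = 1) (hR : 0 < R) (hp : ‖p‖ ≤ R)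
    (h : ‖q - (p + shift R 1 e p • e)‖ ≤ η) (h' : ‖p' - (q + shift R' 0 e q • e)‖ ≤ η') (v : F) :
    (R - ‖p‖) / 2 * |inner ℝ e v| ≤ |inner ℝ q v - inner ℝ p' v| + (η + η') * ‖v‖ := by
  have hη : 0 ≤ η := (norm_nonneg _).trans h
  have hη' : 0 ≤ η' := (norm_nonneg _).trans h'
  rcases he with rfl | he
  · rw [inner_zero_left, abs_zero, mul_zero]
    positivity
  have h0 := norm_sub_sub_le_of_shift_zero h'
  set s := (R ^ 2 - ‖p - inner ℝ p e • e‖ ^ 2) / (2 * R) with hs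
  have hs1 : (R - ‖p‖) / 2 ≤ s := by
    rw [hs, le_div_iff₀ (by linarith)]
    nlinarith [norm_sq_eq_of_norm_eq_one he p, sq_nonneg (inner ℝ p e),
      mul_nonneg (norm_nonneg p) (sub_nonneg.2 hp)]
  have h1 : inner ℝ (p + shift R 1 e p • e) e = s := by
    rw [inner_add_left, inner_smul_left, real_inner_self_eq_norm_sq, he, shift, one_mul]
    simp [hs]
  have h2 : s - η ≤ |inner ℝ q e| := by
    have h3 := abs_real_inner_le_norm (q - (p + shift R 1 e p • e)) e
    rw [inner_sub_left, h1, he, mul_one] at h3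
    have := abs_le.1 (h3.trans h)
    linarith [le_abs_self (inner ℝ q e), this.1]
  have h4 : |inner ℝ q e| * |inner ℝ e v| ≤ |inner ℝ q v - inner ℝ p' v| + η' * ‖v‖ := by
    have h5 : inner ℝ q e * inner ℝ e v = (inner ℝ q v - inner ℝ p' v) +
        inner ℝ (p' - (q - inner ℝ q e • e)) v := by
      simp only [inner_sub_left, inner_smul_left, RCLike.conj_to_real]
      ring
    rw [← abs_mul, h5]
    refine (abs_add_le _ _).trans (add_le_add_right ?_ _)
    exact (abs_real_inner_le_norm _ _).trans (mul_le_mul_of_nonneg_right h0 (norm_nonneg v))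
  have h6 : |inner ℝ e v| ≤ ‖v‖ := by simpa [he] using abs_real_inner_le_norm e v
  have h7 := mul_le_mul_of_nonneg_right h2 (abs_nonneg (inner ℝ e v))
  have h8 := mul_le_mul_of_nonneg_right hs1 (abs_nonneg (inner ℝ e v))
  have h9 := mul_le_mul_of_nonneg_left h6 hη
  linarith

end ShiftPair

/-! ### The oscillating function -/

section Oscillating

variable {n : ℕ}

/-- A Lipschitz function which oscillates at the points that are in almost all layers. -/
theorem exists_oscillating {D : ∀ m : ℕ, Layer n ((1 / 4) ^ m / 80)}
    {b : ℕ → EuclideanSpace ℝ (Fin n)}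
    (hb : ∀ w, ∃ᶠ m in atTop, ‖w‖ / (n + 1) ≤ |inner ℝ (b m) w|)
    {T : EuclideanSpace ℝ (Fin n) → Submodule ℝ (EuclideanSpace ℝ (Fin n))}
    (hD : ∀ m l, ∀ x ∈ (D m).K l, ∀ v,
      |inner ℝ (b m) (v - (T x).starProjection v)| ≤
        |inner ℝ ((D m).e l) v| + (1 / 4) ^ m / 80 * ‖v‖) :
    ∃ f : EuclideanSpace ℝ (Fin n) → ℝ, (∃ C, LipschitzWith C f) ∧
      ∀ x, (∀ᶠ m in atTop, x ∈ ⋃ l, (D m).K l) → ∃ c : ℝ, 0 < c ∧ ∀ v,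
        c * Metric.infDist v (T x : Set (EuclideanSpace ℝ (Fin n))) ≤
          upperDeriv f x v - lowerDeriv f x v := by
  have hpow1 : ∀ m : ℕ, (1 / 2 : ℝ) ^ m ≤ 1 := fun m =>
    pow_le_one₀ (by norm_num) (by norm_num)
  have hpow0 : ∀ m : ℕ, (0 : ℝ) < (1 / 2) ^ m := fun m => by positivity
  have hpow4 : ∀ m : ℕ, (1 / 4 : ℝ) ^ m = (1 / 2) ^ (2 * m) := fun m => by
    rw [pow_mul]; norm_num
  -- Layer `D m` serves step `2 * m`, which raises (`θ = 1`), and step `2 * m + 1`, which erases (`θ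
  -- = 0`). The radius grows by `2 * η j` per step, and `80` gives `8 * R * α ≤ (1 / 2) ^ (2 * m +
  -- 1)`.
  obtain ⟨f, p, r, ⟨C, hC⟩, hr, hpR, hpK, happ⟩ := exists_lipschitz_limit
    (α := fun j => (1 / 4) ^ (j / 2) / 80) (θ := fun j => if Even j then 1 else 0)
    (R := fun j => 5 - 4 * (1 / 2) ^ j) (η := fun j => (1 / 2) ^ j) (B := 5)
    (fun j => D (j / 2)) (fun j => by linarith [hpow1 j]) (fun j => by linarith [hpow0 j])
    (fun j => by split_ifs <;> simp) (fun j => by positivity)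
    (fun j => by rw [hpow4]; linarith [hpow1 (2 * (j / 2))]) hpow0
    (fun j => by
      have h1 : (1 / 2 : ℝ) * (1 / 4) ^ (j / 2) ≤ (1 / 2) ^ j := by
        rw [hpow4, ← pow_succ']
        exact pow_le_pow_of_le_one (by norm_num) (by norm_num) (by omega)
      nlinarith [mul_pos (hpow0 j) (show (0 : ℝ) < (1 / 4) ^ (j / 2) by positivity)])
    (fun j => by rw [pow_succ]; linarith [hpow0 j])
  refine ⟨f, ⟨C, hC⟩, fun x hx => ?_⟩
  obtain ⟨m₀, hm₀⟩ := eventually_atTop.1 hx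
  have hpair : ∀ m, m₀ ≤ m → ∃ l, x ∈ (D m).K l ∧
      ‖p (2 * m + 1) x - (p (2 * m) x +
        shift (5 - 4 * (1 / 2) ^ (2 * m)) 1 ((D m).e l) (p (2 * m) x) • (D m).e l)‖
          ≤ (1 / 2) ^ (2 * m) ∧
      ‖p (2 * m + 2) x - (p (2 * m + 1) x +
        shift (5 - 4 * (1 / 2) ^ (2 * m + 1)) 0 ((D m).e l) (p (2 * m + 1) x) • (D m).e l)‖
          ≤ (1 / 2) ^ (2 * m + 1) := fun m hm => by
    obtain ⟨l, hl⟩ := mem_iUnion.1 (hm₀ m hm)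
    have h1 := hpK (2 * m)
    have h2 := hpK (2 * m + 1)
    rw [show 2 * m / 2 = m by omega, if_pos (even_two_mul m)] at h1
    rw [show (2 * m + 1) / 2 = m by omega, if_neg (by simp)] at h2
    exact ⟨l, hl, h1 l x hl, h2 l x hl⟩
  set d : ℝ := (1 / 2) ^ (2 * m₀) with hd
  have hd0 : 0 < d := hpow0 _
  have hd1 : d ≤ 1 := hpow1 _
  have hstep : ∀ m, m₀ ≤ m → ‖p (2 * (m + 1)) x‖ + ((1 / 2) ^ (2 * m) + (1 / 2) ^ (2 * m + 1)) ≤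
      ‖p (2 * m) x‖ + (5 - 4 * (1 / 2) ^ (2 * (m + 1))) - (5 - 4 * (1 / 2) ^ (2 * m)) :=
    fun m hm => by
      obtain ⟨l, -, h1, h2⟩ := hpair m hm
      have := norm_le_of_shift_pair (((D m).dir l).imp_right fun h => h.1) h1 h2
      rw [show 2 * (m + 1) = 2 * m + 2 by ring]
      rw [pow_succ] at this ⊢
      rw [pow_succ _ (2 * m + 1), pow_succ]
      linarith
  -- Each pair widens the gap by at least its own errors; the pair `m₀` alone already contributes
  -- `d`.
  have hgap : ∀ m, m₀ + 1 ≤ m → d ≤ (5 - 4 * (1 / 2) ^ (2 * m)) - ‖p (2 * m) x‖ := by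
    intro m hm
    induction m, hm using Nat.le_induction with
    | base => linarith [hstep m₀ le_rfl, hpR (2 * m₀) x, hpow0 (2 * m₀ + 1)]
    | succ m hm ih => linarith [hstep m (by omega), hpow0 (2 * m), hpow0 (2 * m + 1)]
  refine ⟨d / (2 * (n + 1)), by positivity, fun v => ?_⟩
  set w := v - (T x).starProjection v with hw
  have hdist : Metric.infDist v (T x : Set (EuclideanSpace ℝ (Fin n))) ≤ ‖w‖ := by
    rw [hw, ← dist_eq_norm]
    exact Metric.infDist_le_dist_of_mem ((T x).starProjection_apply_mem v)
  refine (mul_le_mul_of_nonneg_left hdist (by positivity)).trans ?_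
  refine le_upperDeriv_sub_lowerDeriv hC fun ε hε ρ hρ => ?_
  -- The `9` collects `6` from the two difference quotients, `2` from the gradient errors and `1`
  -- from the aperture term.
  have hsmall : ∀ᶠ m : ℕ in atTop, 1 / ((m : ℝ) + 1) < min ρ (ε / (9 * (‖v‖ + 1))) :=
    tendsto_one_div_add_atTop_nhds_zero_nat.eventually_lt_const (by positivity)
  obtain ⟨m, hbm, hms, hm⟩ := ((hb w).and_eventually
    (hsmall.and (eventually_ge_atTop (m₀ + 1)))).exists
  obtain ⟨l, hl, h1, h2⟩ := hpair m (by omega)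
  have hosc := le_abs_inner_of_shift_pair (((D m).dir l).imp_right fun h => h.1)
    (by linarith [hpow1 (2 * m)]) (hpR (2 * m) x) h1 h2 v
  have hq1 := abs_quotient_sub_le (v := v) (hr (2 * m + 1)).1 (happ (2 * m + 1) x)
  have hq2 := abs_quotient_sub_le (v := v) (hr (2 * m + 2)).1 (happ (2 * m + 2) x)
  set κ : ℝ := 1 / ((m : ℝ) + 1) with hκ
  have hκ0 : 0 < κ := by positivity
  have hκρ : κ < ρ := hms.trans_le (min_le_left _ _)
  have hκε : 9 * κ * (‖v‖ + 1) ≤ ε := by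
    have := (hms.trans_le (min_le_right _ _)).le
    rw [le_div_iff₀ (by positivity)] at this
    linarith
  have hpowκ : (1 / 2 : ℝ) ^ (2 * m) ≤ κ := by
    rw [hκ, one_div_pow]
    refine one_div_le_one_div_of_le (by positivity) ?_
    have : m + 1 ≤ 2 ^ (2 * m) :=
      Nat.lt_two_pow_self.trans_le (Nat.pow_le_pow_right (by norm_num) (by omega))
    exact_mod_cast this
  have htime : ∀ j, 2 * m + 1 ≤ j → 0 < r j / (‖v‖ + 1) ∧ r j / (‖v‖ + 1) < ρ := fun j hj => by
    refine ⟨div_pos (hr j).1 (by positivity), lt_of_le_of_lt ?_ hκρ⟩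
    refine (div_le_self (hr j).1.le (by linarith [norm_nonneg v])).trans ((hr j).2.trans ?_)
    refine one_div_le_one_div_of_le (by positivity) ?_
    have : m ≤ j := by omega
    gcongr
  have h3κ : ∀ j, 2 * m + 1 ≤ j → 3 / ((j : ℝ) + 1) ≤ 3 * κ := fun j hj => by
    rw [hκ, mul_one_div]
    have : m ≤ j := by omega
    gcongr
  refine ⟨_, _, htime (2 * m + 1) le_rfl, htime (2 * m + 2) (by omega), ?_⟩
  set Q1 := (f (x + (r (2 * m + 1) / (‖v‖ + 1)) • v) - f x) / (r (2 * m + 1) / (‖v‖ + 1))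
  set Q2 := (f (x + (r (2 * m + 2) / (‖v‖ + 1)) • v) - f x) / (r (2 * m + 2) / (‖v‖ + 1))
  have hv : 0 < ‖v‖ + 1 := by positivity
  have e1 := hq1.trans (mul_le_mul_of_nonneg_right (h3κ _ le_rfl) hv.le)
  have e2 := hq2.trans (mul_le_mul_of_nonneg_right (h3κ _ (by omega)) hv.le)
  have e3 : |inner ℝ (p (2 * m + 1) x) v - inner ℝ (p (2 * m + 2) x) v| ≤
      |Q1 - Q2| + 6 * κ * (‖v‖ + 1) := by
    rw [abs_le] at e1 e2
    rcases abs_cases (Q1 - Q2) with ⟨h, -⟩ | ⟨h, -⟩ <;> rw [h] <;>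
      refine abs_le.2 ⟨?_, ?_⟩ <;> linarith [e1.1, e1.2, e2.1, e2.2, abs_nonneg (Q1 - Q2),
        le_abs_self (Q1 - Q2), neg_abs_le (Q1 - Q2)]
  have e4 : ‖w‖ / (n + 1) ≤ |inner ℝ ((D m).e l) v| + κ * ‖v‖ := by
    refine (hbm.trans (hD m l x hl v)).trans (add_le_add_right ?_ _)
    refine mul_le_mul_of_nonneg_right ?_ (norm_nonneg v)
    rw [hpow4]
    linarith [hpow0 (2 * m)]
  have e5 := mul_le_mul_of_nonneg_right (hgap m hm) (abs_nonneg (inner ℝ ((D m).e l) v))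
  have e6 : d / (2 * (n + 1)) * ‖w‖ = d / 2 * (‖w‖ / (n + 1)) := by field_simp
  have e7 := mul_le_mul_of_nonneg_left e4 (half_pos hd0).le
  have e8 : (1 / 2 : ℝ) ^ (2 * m + 1) ≤ κ := by
    rw [pow_succ]; linarith [hpow0 (2 * m)]
  have e9 := mul_le_mul_of_nonneg_right (add_le_add hpowκ e8) (norm_nonneg v)
  have e10 : d / 2 * (κ * ‖v‖) ≤ κ * ‖v‖ :=
    mul_le_of_le_one_left (by positivity) (by linarith)
  rw [e6]
  linarith

end Oscillating

end ConeWidth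

/-! ### The corollary -/

theorem mainTheorem6 (n : ℕ) (μ : Measure (EuclideanSpace ℝ (Fin n)))
    [IsLocallyFiniteMeasure μ]
    (T : EuclideanSpace ℝ (Fin n) → Submodule ℝ (EuclideanSpace ℝ (Fin n)))
    (hT : ConeWidth.MeasurableField μ T)
    (hw : ∀ e : EuclideanSpace ℝ (Fin n), ‖e‖ = 1 → ∀ α : ℝ, 0 < α → α < 1 →
      ∃ Z E : Set (EuclideanSpace ℝ (Fin n)), μ Z = 0 ∧ ConeWidth.width e α E = 0 ∧
        {x | ConeWidth.cone e α ∩ (T x : Set (EuclideanSpace ℝ (Fin n))) = {0}} = Z ∪ E) :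
    ∃ f : EuclideanSpace ℝ (Fin n) → ℝ, (∃ K, LipschitzWith K f) ∧
      ∀ᵐ x ∂μ, ∃ c : ℝ, 0 < c ∧ ∀ v : EuclideanSpace ℝ (Fin n),
        c * Metric.infDist v (T x : Set (EuclideanSpace ℝ (Fin n))) ≤
          ConeWidth.upperDeriv f x v - ConeWidth.lowerDeriv f x v := by
  -- Only null sets matter, so `μ` may be replaced by an equivalent finite measure, for which the
  -- layers can miss sets of summable measure.
  obtain ⟨ν, hν, hμν, hνμ⟩ := exists_isFiniteMeasure_absolutelyContinuous μ
  obtain ⟨b, hb1, hb⟩ := ConeWidth.exists_recurrent_directions n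
  have hpow : ∀ m : ℕ, (1 / 4 : ℝ) ^ m ≤ 1 := fun m => pow_le_one₀ (by norm_num) (by norm_num)
  have hTν : ConeWidth.MeasurableField ν T := fun U hU => (hT U hU).mono_ac hνμ
  choose D hDν hD using fun m : ℕ => ConeWidth.exists_layer hTν (α := (1 / 4) ^ m / 80)
    (by positivity) (fun e he => by
      obtain ⟨Z, E, hZ, h⟩ := hw e he ((1 / 4) ^ m / 80) (by positivity) (by linarith [hpow m])
      exact ⟨Z, E, hνμ hZ, h⟩) (hb1 m) (ε := 2⁻¹ ^ m) (by simp)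
  obtain ⟨f, hf, hosc⟩ := ConeWidth.exists_oscillating hb hD
  refine ⟨f, hf, hμν.ae_le ?_⟩
  have hsum : ∑' m, ν (⋃ l, (D m).K l)ᶜ ≠ ⊤ := by
    refine ne_top_of_le_ne_top ?_ (ENNReal.tsum_le_tsum hDν)
    rw [ENNReal.tsum_geometric, ENNReal.one_sub_inv_two]
    simp
  filter_upwards [ae_eventually_notMem hsum] with x hx
  exact hosc x (hx.mono fun m hm => not_not.1 hm)
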